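/- Let $a\in\mathbb{R}$ and $\sigma_{v1},\sigma_{v2}\ge 0$ satisfy $|a|\ge 2.5$, $\sigma_{v1}\le\sigma_{v2}$ and $\sigma_{v2}^2\le\max(1,a^2\sigma_{v1}^2)$ (the weakly-degraded-observation case). For $\sigma_0\ge 0$ consider the system $$x[n+1]=a\,x[n]+u_1[n]+u_2[n]+w[n],\qquad y_1[n]=x[n]+v_1[n],\qquad y_2[n]=x[n]+v_2[n]\qquad(n\ge 0),$$ where $x[0]\sim\mathcal N(0,\sigma_0^2)$, $w[n]\sim\mathcal N(0,1)$, $v_1[n]\sim\mathcal N(0,\sigma_{v1}^2)$, $v_2[n]\sim\mathcal N(0,\sigma_{v2}^2)$ are all independent, and where the control strategies are measurable and causal: $u_i[n]$ is a measurable function of $y_i[0],\dots,y_i[n]$, for $i=1,2$. There is a function $D_L:[0,\infty)^2\to[0,\infty]$, depending only on $a,\sigma_{v1},\sigma_{v2}$, such that for all $\sigma_0\ge 0$ and all $q,r_1,r_2\ge 0$ $$\inf_{u_1,u_2}\ \limsup_{N\to\infty}\frac1N\sum_{0\le n<N}\Big(q\,\mathbb E[x^2[n]]+r_1\mathbb E[u_1^2[n]]+r_2\mathbb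 E[u_2^2[n]]\Big)\ \ge\ \min_{\widetilde P_1,\widetilde P_2\ge 0}\Big(q\,D_L(\widetilde P_1,\widetilde P_2)+r_1\widetilde P_1+r_2\widetilde P_2\Big),$$ where the infimum is over all measurable causal strategies, the minimum on the right is attained, and $0\cdot\infty=0$; and such that (a) if $\widetilde P_1\le\frac{1}{400}a^2\max(1,a^2\sigma_{v1}^2)$ and $\widetilde P_2\le\frac{1}{400}a^2\max(1,a^2\sigma_{v2}^2)$, then $D_L(\widetilde P_1,\widetilde P_2)=\infty$; (b) if $\widetilde P_1\le\frac{1}{400}a^2\max(1,a^2\sigma_{v1}^2)$, then $D_L(\widetilde P_1,\widetilde P_2)\ge 0.176\,a^2\sigma_{v2}^2+1$ for all $\widetilde P_2\ge 0$; (c) $D_L(\widetilde P_1,\widetilde P_2)\ge 0.295\max(1,a^2\sigma_{v1}^2)$ for all $\widetilde P_1,\widetilde P_2\ge 0$. -/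

import Mathlib

open MeasureTheory ProbabilityTheory Filter
open scoped NNReal ENNReal

/-- Labels of the primitive random variables of the control problem: the initial state, the
disturbances, and the observation noises of the two controllers. -/
inductive NoiseIndex : Type
  | init : NoiseIndex
  | dist : ℕ → NoiseIndex
  | obs₁ : ℕ → NoiseIndex
  | obs₂ : ℕ → NoiseIndex

/-- Variances of the primitive random variables: `x[0]` has variance `σ₀ ^ 2`, every `w[n]` has
variance `1`, every `v₁[n]` has variance `σ₁ ^ 2` and every `v₂[n]` has variance `σ₂ ^ 2`. -/
def noiseVariance (σ₀ σ₁ σ₂ : ℝ≥0) : NoiseIndex → ℝ≥0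
  | .init => σ₀ ^ 2
  | .dist _ => 1
  | .obs₁ _ => σ₁ ^ 2
  | .obs₂ _ => σ₂ ^ 2

/-- The joint law of the primitive random variables: independent centred Gaussians. -/
noncomputable def noiseLaw (σ₀ σ₁ σ₂ : ℝ≥0) : Measure (NoiseIndex → ℝ) :=
  Measure.infinitePi fun i => gaussianReal 0 (noiseVariance σ₀ σ₁ σ₂ i)

/-- A measurable causal control strategy: the input at time `n` is a measurable function of the
controller's own observations `y[0], …, y[n]`. -/
structure CausalStrategy : Type where
  toFun : (n : ℕ) → (Fin (n + 1) → ℝ) → ℝ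
  measurable_toFun : ∀ n, Measurable (toFun n)

/-- The state `x[n]` of the closed loop
`x[n+1] = a x[n] + u₁[n] + u₂[n] + w[n]`, where `uᵢ[n] = fᵢ (yᵢ[0], …, yᵢ[n])` and
`yᵢ[k] = x[k] + vᵢ[k]`. -/
noncomputable def state (a : ℝ) (f₁ f₂ : CausalStrategy) (ω : NoiseIndex → ℝ) : ℕ → ℝ
  | 0 => ω .init
  | n + 1 =>
      a * state a f₁ f₂ ω n
        + f₁.toFun n (fun k : Fin (n + 1) => state a f₁ f₂ ω k.1 + ω (.obs₁ k.1))
        + f₂.toFun n (fun k : Fin (n + 1) => state a f₁ f₂ ω k.1 + ω (.obs₂ k.1))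
        + ω (.dist n)
  termination_by n => n
  decreasing_by
    · exact Nat.lt_succ_self n
    · exact k.2
    · exact k.2

/-- The input `u₁[n]` of the first controller. -/
noncomputable def input₁ (a : ℝ) (f₁ f₂ : CausalStrategy) (ω : NoiseIndex → ℝ) (n : ℕ) : ℝ :=
  f₁.toFun n fun k : Fin (n + 1) => state a f₁ f₂ ω k.1 + ω (.obs₁ k.1)

/-- The input `u₂[n]` of the second controller. -/
noncomputable def input₂ (a : ℝ) (f₁ f₂ : CausalStrategy) (ω : NoiseIndex → ℝ) (n : ℕ) : ℝ :=
  f₂.toFun n fun k : Fin (n + 1) => state a f₁ f₂ ω k.1 + ω (.obs₂ k.1)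

/-- The second moment `𝔼[X ^ 2] ∈ [0, ∞]`. -/
noncomputable def secondMoment (μ : Measure (NoiseIndex → ℝ)) (X : (NoiseIndex → ℝ) → ℝ) : ℝ≥0∞ :=
  ∫⁻ ω, ENNReal.ofReal (X ω ^ 2) ∂μ

/-- The long-term average cost of a pair of strategies,
`limsup_N (1/N) ∑_{0 ≤ n < N} q 𝔼[x[n]²] + r₁ 𝔼[u₁[n]²] + r₂ 𝔼[u₂[n]²]`. -/
noncomputable def averageCost (a : ℝ) (σ₀ σ₁ σ₂ q r₁ r₂ : ℝ≥0) (f₁ f₂ : CausalStrategy) : ℝ≥0∞ :=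
  limsup
    (fun N : ℕ =>
      (∑ n ∈ Finset.range N,
        ((q : ℝ≥0∞) * secondMoment (noiseLaw σ₀ σ₁ σ₂) (fun ω => state a f₁ f₂ ω n)
          + (r₁ : ℝ≥0∞) * secondMoment (noiseLaw σ₀ σ₁ σ₂) (fun ω => input₁ a f₁ f₂ ω n)
          + (r₂ : ℝ≥0∞) * secondMoment (noiseLaw σ₀ σ₁ σ₂) (fun ω => input₂ a f₁ f₂ ω n)))
        / (N : ℝ≥0∞))
    atTop

/-- The infimum of the long-term average cost over all pairs of measurable causal strategies. -/
noncomputable def optimalCost (a : ℝ) (σ₀ σ₁ σ₂ q r₁ r₂ : ℝ≥0) : ℝ≥0∞ :=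
  ⨅ (f₁ : CausalStrategy) (f₂ : CausalStrategy), averageCost a σ₀ σ₁ σ₂ q r₁ r₂ f₁ f₂

/-!
The history of both controllers determines the state `x[n]` up to an innovation: `x[n] = e + φ`,
where `φ` is a function of the past observations and `e` is centred Gaussian and independent of them,
whatever the (nonlinear) strategies are. The variance of `e` follows the Kalman recursion of the
uncontrolled system, so it climbs above `3 / 10 * max 1 (a² σ₁²)` (`exists_isInnovation`). This gives
the bound that holds for all powers (`le_secondMoment_state`).

Conditionally on the past, one time step is a static team problem: controller `i` observes `e + vᵢ`,
and both try to cancel `a e`. The Gaussian variable `z = σ₂² e - P v₂`, `P = Var e`, is independent of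
the past and of `e + v₂`, hence of all that the second controller can contribute, while the first
controller can reduce the correlation of `z` with the state only in proportion to its power. Testing
the next state against `z` yields
`𝔼 x[n+1]² + K 𝔼 u₁[n]² ≥ 1 + (27 / 130) a² σ₂²` (`le_secondMoment_state_succ_add`). As it is linear in
the second moments, it can be averaged over time, and it bounds the state from below when the average
power of the first controller is small. Here `σ₂² ≤ max 1 (a² σ₁²)` makes `P` at least of order `σ₂²`.

If both average powers are small, the state is by the previous bound too large for the controls to
compensate the instability: its cumulative second moment at least doubles in every step
(`mul_secondMoment_state_le`, `eventually_two_mul_le`), and the average is infinite.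

The lower bound `distortionBound` is the step function with these three values. For given strategies,
the value that applies depends on which controllers exceed their power threshold infinitely often
(`min_le_limsup_cost`).
-/

/-! ### Independence and linear forms in independent Gaussian variables -/

section LinearForms

variable {Ω : Type*} {mΩ : MeasurableSpace Ω} {μ : Measure Ω}

theorem indepFun_prodMk_of_indepFun_prodMk {α β γ : Type*} [MeasurableSpace α]
    [MeasurableSpace β] [MeasurableSpace γ] [IsProbabilityMeasure μ]
    {X : Ω → α} {Y : Ω → β} {Z : Ω → γ} (hX : Measurable X) (hY : Measurable Y) (hZ : Measurable Z)
    (hXY : IndepFun X Y μ) (hXYZ : IndepFun (fun ω => (X ω, Y ω)) Z μ) :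
    IndepFun X (fun ω => (Y ω, Z ω)) μ := by
  have hYZ : IndepFun Y Z μ := hXYZ.comp measurable_snd measurable_id
  have := Measure.isProbabilityMeasure_map hX.aemeasurable (μ := μ)
  have := Measure.isProbabilityMeasure_map hY.aemeasurable (μ := μ)
  have := Measure.isProbabilityMeasure_map hZ.aemeasurable (μ := μ)
  rw [indepFun_iff_map_prod_eq_prod_map_map (by fun_prop) (by fun_prop)] at hXY hXYZ hYZ ⊢
  rw [hYZ, ← Measure.prodAssoc_prod, ← hXY, ← hXYZ,
    Measure.map_map MeasurableEquiv.prodAssoc.measurable (by fun_prop)]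
  rfl

/-- The family `Z` is jointly Gaussian and centred, and its members are uncorrelated (hence
independent) with variances `s`. -/
structure IsGaussianNoise {ι : Type*} [Fintype ι] [DecidableEq ι] (Z : ι → Ω → ℝ) (s : ι → ℝ)
    (μ : Measure Ω) : Prop where
  measurable : ∀ i, Measurable (Z i)
  hasGaussianLaw : HasGaussianLaw (fun ω i => Z i ω) μ
  integral_eq_zero : ∀ i, ∫ ω, Z i ω ∂μ = 0
  covariance_eq : ∀ i j, cov[Z i, Z j; μ] = if i = j then s i else 0

/-- The linear form `∑ i, c i * Z i` in the random variables `Z`. -/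
def linForm {ι : Type*} [Fintype ι] (c : ι → ℝ) (Z : ι → Ω → ℝ) (ω : Ω) : ℝ := ∑ i, c i * Z i ω

namespace IsGaussianNoise

variable {ι : Type*} [Fintype ι] [DecidableEq ι] {Z : ι → Ω → ℝ} {s : ι → ℝ}

theorem isProbabilityMeasure (hZ : IsGaussianNoise Z s μ) : IsProbabilityMeasure μ :=
  hZ.hasGaussianLaw.isProbabilityMeasure

theorem memLp (hZ : IsGaussianNoise Z s μ) (i : ι) : MemLp (Z i) 2 μ :=
  (hZ.hasGaussianLaw.eval i).memLp_two

theorem measurable_linForm (hZ : IsGaussianNoise Z s μ) (c : ι → ℝ) :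
    Measurable (linForm c Z) := by
  have := hZ.measurable
  unfold linForm
  fun_prop

theorem memLp_linForm (hZ : IsGaussianNoise Z s μ) (c : ι → ℝ) : MemLp (linForm c Z) 2 μ :=
  memLp_finsetSum _ fun i _ => (hZ.memLp i).const_mul (c i)

theorem integral_linForm (hZ : IsGaussianNoise Z s μ) (c : ι → ℝ) :
    ∫ ω, linForm c Z ω ∂μ = 0 := by
  have := hZ.isProbabilityMeasure
  unfold linForm
  rw [integral_finsetSum _ fun i _ => ((hZ.memLp i).const_mul (c i)).integrable one_le_two]
  simp [integral_const_mul, hZ.integral_eq_zero]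

theorem covariance_linForm (hZ : IsGaussianNoise Z s μ) (c d : ι → ℝ) :
    cov[linForm c Z, linForm d Z; μ] = ∑ i, c i * d i * s i := by
  have := hZ.isProbabilityMeasure
  unfold linForm
  rw [covariance_fun_sum_fun_sum (fun i => (hZ.memLp i).const_mul (c i))
    (fun i => (hZ.memLp i).const_mul (d i))]
  refine Finset.sum_congr rfl fun i _ => ?_
  simp only [covariance_const_mul_left, covariance_const_mul_right, hZ.covariance_eq]
  simp only [mul_ite, mul_zero, Finset.sum_ite_eq, Finset.mem_univ, if_true]
  ring

theorem integral_linForm_mul (hZ : IsGaussianNoise Z s μ) (c d : ι → ℝ) :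
    ∫ ω, linForm c Z ω * linForm d Z ω ∂μ = ∑ i, c i * d i * s i := by
  have := hZ.isProbabilityMeasure
  rw [← hZ.covariance_linForm, covariance_eq_sub (hZ.memLp_linForm c) (hZ.memLp_linForm d)]
  simp [hZ.integral_linForm]

theorem integral_linForm_sq (hZ : IsGaussianNoise Z s μ) (c : ι → ℝ) :
    ∫ ω, linForm c Z ω ^ 2 ∂μ = ∑ i, c i ^ 2 * s i := by
  simpa only [sq] using hZ.integral_linForm_mul c c

theorem hasGaussianLaw_linForm (hZ : IsGaussianNoise Z s μ) (c : ι → ℝ) :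
    HasGaussianLaw (linForm c Z) μ := by
  have h := hZ.hasGaussianLaw.map_fun
    (∑ i, c i • (ContinuousLinearMap.proj i : (ι → ℝ) →L[ℝ] ℝ))
  have hc : linForm c Z =
      fun ω => (∑ i, c i • (ContinuousLinearMap.proj i : (ι → ℝ) →L[ℝ] ℝ)) fun i => Z i ω := by
    ext ω
    simp [linForm]
  rwa [hc]

/-- If the block `Z` is independent of `H`, a linear form in `Z` which is uncorrelated with some
other linear forms in `Z` is independent of `H` and these forms together. -/
theorem indepFun_linForm (hZ : IsGaussianNoise Z s μ) {α : Type*} [MeasurableSpace α] {H : Ω → α}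
    (hH : Measurable H) (hHZ : IndepFun H (fun ω i => Z i ω) μ) {κ : Type*} [Fintype κ]
    {c : ι → ℝ} {d : κ → ι → ℝ} (hcd : ∀ k, ∑ i, c i * d k i * s i = 0) :
    IndepFun (linForm c Z) (fun ω => (H ω, fun k => linForm (d k) Z ω)) μ := by
  have := hZ.isProbabilityMeasure
  have hm := hZ.measurable
  have hc := hZ.measurable_linForm c
  have hd := fun k => hZ.measurable_linForm (d k)
  have hcd' : IndepFun (linForm c Z) (fun ω k => linForm (d k) Z ω) μ := by
    let L : (ι → ℝ) →L[ℝ] (Unit → ℝ) × (κ → ℝ) :=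
      (ContinuousLinearMap.pi fun _ =>
          ∑ i, c i • (ContinuousLinearMap.proj i : (ι → ℝ) →L[ℝ] ℝ)).prod
        (ContinuousLinearMap.pi fun k =>
          ∑ i, d k i • (ContinuousLinearMap.proj i : (ι → ℝ) →L[ℝ] ℝ))
    have hL : (fun ω => (fun _ : Unit => linForm c Z ω, fun k => linForm (d k) Z ω)) =
        fun ω => L fun i => Z i ω := by
      funext ω
      ext <;> simp [linForm, L]
    have h' : HasGaussianLaw (fun ω => (fun _ : Unit => linForm c Z ω,
        fun k => linForm (d k) Z ω)) μ := by
      rw [hL]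
      exact hZ.hasGaussianLaw.map_fun L
    exact (h'.indepFun_of_covariance_eval fun _ k => by
      rw [hZ.covariance_linForm, hcd k]).comp (measurable_pi_apply ()) measurable_id
  have hH' : IndepFun (fun ω => (linForm c Z ω, fun k => linForm (d k) Z ω)) H μ :=
    (hHZ.comp (φ := id) (ψ := fun z : ι → ℝ => (∑ i, c i * z i, fun k => ∑ i, d k i * z i))
      measurable_id (by fun_prop)).symm
  exact (indepFun_prodMk_of_indepFun_prodMk hc (by fun_prop) hH hcd' hH').comp measurable_id
    measurable_swap

end IsGaussianNoise

/-- Adding an independent centred variable increases the second moment by its variance. -/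
theorem le_lintegral_add_sq_of_indepFun [IsProbabilityMeasure μ] {X Y : Ω → ℝ}
    (hX : MemLp X 2 μ) (hX0 : ∫ ω, X ω ∂μ = 0) (hY : Measurable Y) (hXY : IndepFun X Y μ) :
    ENNReal.ofReal (∫ ω, X ω ^ 2 ∂μ) + ∫⁻ ω, ENNReal.ofReal (Y ω ^ 2) ∂μ ≤
      ∫⁻ ω, ENNReal.ofReal ((X ω + Y ω) ^ 2) ∂μ := by
  by_cases hYL : MemLp Y 2 μ
  · have hmul : ∫ ω, X ω * Y ω ∂μ = 0 := by
      rw [hXY.integral_fun_mul_eq_mul_integral hX.aestronglyMeasurable hYL.aestronglyMeasurable,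
        hX0, zero_mul]
    have hXY2 : Integrable (fun ω => (X ω + Y ω) ^ 2) μ := (hX.add hYL).integrable_sq
    rw [← ofReal_integral_eq_lintegral_ofReal hYL.integrable_sq (ae_of_all _ fun ω => sq_nonneg _),
      ← ofReal_integral_eq_lintegral_ofReal hXY2
        (ae_of_all _ fun ω => sq_nonneg _),
      ← ENNReal.ofReal_add (integral_nonneg fun ω => sq_nonneg _)
        (integral_nonneg fun ω => sq_nonneg _)]
    refine ENNReal.ofReal_le_ofReal (le_of_eq ?_)
    have h : ∀ ω, (X ω + Y ω) ^ 2 = X ω ^ 2 + Y ω ^ 2 + 2 * (X ω * Y ω) := fun ω => by ring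
    have hint : Integrable (fun ω => X ω * Y ω) μ := hX.integrable_mul hYL
    simp only [h]
    have hint2 : Integrable (fun ω => X ω ^ 2 + Y ω ^ 2) μ :=
      hX.integrable_sq.add hYL.integrable_sq
    rw [integral_add hint2 (hint.const_mul 2),
      integral_add hX.integrable_sq hYL.integrable_sq, integral_const_mul, hmul]
    simp
  · suffices h : ∫⁻ ω, ENNReal.ofReal ((X ω + Y ω) ^ 2) ∂μ = ∞ by simp [h]
    by_contra hfin
    have hm : AEStronglyMeasurable (fun ω => X ω + Y ω) μ :=
      hX.aestronglyMeasurable.add hY.aestronglyMeasurable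
    have hsum : MemLp (fun ω => X ω + Y ω) 2 μ := by
      rw [memLp_two_iff_integrable_sq hm]
      refine (lintegral_ofReal_ne_top_iff_integrable (hm.pow 2)
        (ae_of_all _ fun ω => sq_nonneg _)).1 hfin
    refine hYL ?_
    convert hsum.sub hX using 1
    ext ω
    simp

end LinearForms

/-! ### One stage of the closed loop -/

/-- The gains of the linear estimator of a centred Gaussian state of variance `P` from two
observations with noise variances `s₁ ≤ s₂`; `(1 - l₁ - l₂) * P` is the error variance.
The last inequality says that the two observations are together no better than two observations
with noise variance `s₁`. -/
theorem exists_estimator_gains {P s₁ s₂ : ℝ} (hP : 0 ≤ P) (h₁ : 0 ≤ s₁) (h₁₂ : s₁ ≤ s₂) :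
    ∃ l₁ l₂ : ℝ, (1 - l₁ - l₂) * P = l₁ * s₁ ∧ (1 - l₁ - l₂) * P = l₂ * s₂ ∧
      s₁ * P ≤ (1 - l₁ - l₂) * P * (s₁ + 2 * P) := by
  have h₂ : 0 ≤ s₂ := h₁.trans h₁₂
  have a1 := mul_nonneg hP h₁
  have a2 := mul_nonneg hP h₂
  have a3 := mul_nonneg h₁ h₂
  rcases (add_nonneg (add_nonneg a1 a2) a3).eq_or_lt with hD | hD
  · have e2 : P * s₂ = 0 := by linarith
    have e3 : s₁ * s₂ = 0 := by linarith
    have e4 : s₁ = 0 := by nlinarith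
    have e1 : P * s₁ = 0 := by linarith
    exact ⟨1, 0, by simp [e4], by simp, by simp [e4]⟩
  · have hD' := hD.ne'
    have hl : 1 - P * s₂ / (P * s₁ + P * s₂ + s₁ * s₂) - P * s₁ / (P * s₁ + P * s₂ + s₁ * s₂) =
        s₁ * s₂ / (P * s₁ + P * s₂ + s₁ * s₂) := by
      rw [eq_div_iff hD', sub_mul, sub_mul, div_mul_cancel₀ _ hD', div_mul_cancel₀ _ hD']
      ring
    refine ⟨P * s₂ / (P * s₁ + P * s₂ + s₁ * s₂), P * s₁ / (P * s₁ + P * s₂ + s₁ * s₂),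
      ?_, ?_, ?_⟩
    · rw [hl]; ring
    · rw [hl]; ring
    · rw [hl, div_mul_eq_mul_div, div_mul_eq_mul_div, le_div_iff₀ hD]
      nlinarith [mul_nonneg a1 (mul_nonneg hP (sub_nonneg.2 h₁₂))]

section Stage

variable {Ω : Type*} {mΩ : MeasurableSpace Ω} {μ : Measure Ω} {α : Type*} [MeasurableSpace α]
  {Z : Fin 4 → Ω → ℝ} {P s₁ s₂ : ℝ} {H : Ω → α}

/-- The disturbance of a stage contributes its unit variance to the next second moment, since it is
independent of the history, of the state and of both observation noises. -/
theorem one_add_lintegral_sq_le (hZ : IsGaussianNoise Z ![P, s₁, s₂, 1] μ)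
    (hH : Measurable H) (hHZ : IndepFun H (fun ω i => Z i ω) μ) {g : α × (Fin 3 → ℝ) → ℝ}
    (hg : Measurable g) :
    1 + ∫⁻ ω, ENNReal.ofReal (g (H ω, ![Z 0 ω, Z 1 ω, Z 2 ω]) ^ 2) ∂μ ≤
      ∫⁻ ω, ENNReal.ofReal ((g (H ω, ![Z 0 ω, Z 1 ω, Z 2 ω]) + Z 3 ω) ^ 2) ∂μ := by
  have := hZ.isProbabilityMeasure
  have hm := hZ.measurable
  have hind := hZ.indepFun_linForm hH hHZ (c := ![0, 0, 0, 1])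
    (d := ![![1, 0, 0, 0], ![0, 1, 0, 0], ![0, 0, 1, 0]])
    (by intro k; fin_cases k <;> simp [Fin.sum_univ_four])
  have hw : linForm ![0, 0, 0, 1] Z = Z 3 := by
    ext ω; simp [linForm, Fin.sum_univ_four]
  have hd : (fun ω => (H ω, fun k => linForm
      ((![![1, 0, 0, 0], ![0, 1, 0, 0], ![0, 0, 1, 0]] : Fin 3 → Fin 4 → ℝ) k) Z ω)) =
      fun ω => (H ω, ![Z 0 ω, Z 1 ω, Z 2 ω]) := by
    funext ω
    congr 1
    ext k
    fin_cases k <;> simp [linForm, Fin.sum_univ_four]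
  rw [hw, hd] at hind
  have hw1 : ∫ ω, Z 3 ω ^ 2 ∂μ = 1 := by
    rw [← hw, hZ.integral_linForm_sq]
    simp [Fin.sum_univ_four]
  have hY : Measurable fun ω => g (H ω, ![Z 0 ω, Z 1 ω, Z 2 ω]) := by
    refine hg.comp (hH.prodMk ?_)
    refine measurable_pi_lambda _ fun k => ?_
    fin_cases k <;> simp [hm]
  have h := le_lintegral_add_sq_of_indepFun (hZ.memLp 3) (hZ.integral_eq_zero 3) hY
    (hind.comp measurable_id hg)
  rw [hw1, ENNReal.ofReal_one] at h
  simpa only [add_comm] using h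

/-- Controls of small power cannot shrink the state. -/
theorem mul_lintegral_sq_le_add (a : ℝ) {X x u₁ u₂ : Ω → ℝ} (hX : Measurable X)
    (hu₁ : Measurable u₁) (hXx : ∀ ω, X ω = a * x ω + u₁ ω + u₂ ω) :
    ENNReal.ofReal (a ^ 2 / 2) * ∫⁻ ω, ENNReal.ofReal (x ω ^ 2) ∂μ ≤
      ∫⁻ ω, ENNReal.ofReal (X ω ^ 2) ∂μ + 2 * (∫⁻ ω, ENNReal.ofReal (u₁ ω ^ 2) ∂μ +
        ∫⁻ ω, ENNReal.ofReal (u₂ ω ^ 2) ∂μ) := by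
  rw [← lintegral_const_mul' _ _ ENNReal.ofReal_ne_top, ← lintegral_add_left (by fun_prop),
    ← lintegral_const_mul' _ _ (by simp), ← lintegral_add_left (by fun_prop)]
  refine lintegral_mono fun ω => ?_
  have h2 : (2 : ℝ≥0∞) = ENNReal.ofReal 2 := by simp
  rw [h2, ← ENNReal.ofReal_add (sq_nonneg _) (sq_nonneg _), ← ENNReal.ofReal_mul (by positivity),
    ← ENNReal.ofReal_mul (by positivity), ← ENNReal.ofReal_add (sq_nonneg _) (by positivity)]
  refine ENNReal.ofReal_le_ofReal ?_
  rw [hXx]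
  nlinarith [sq_nonneg (a * x ω + 2 * u₁ ω + 2 * u₂ ω), sq_nonneg (u₁ ω - u₂ ω)]

/-- Test variable bound for a static team: the state `Z 0` has variance `P`, the first controller
observes `Z 0 + Z 1` and the second one `Z 0 + Z 2`, both knowing `H`. The variable
`z = s₂ * Z 0 - P * Z 2` is independent of everything the second controller knows, so only the
first controller, limited by its power, can reduce the correlation of the state with `z`. -/
theorem le_integral_sq_of_small_first_control (a : ℝ) (hZ : IsGaussianNoise Z ![P, s₁, s₂, 1] μ)
    (hH : Measurable H) (hHZ : IndepFun H (fun ω i => Z i ω) μ) {g₁ g₂ : α × ℝ → ℝ}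
    (hg₁ : Measurable g₁) (hg₂ : Measurable g₂) (hP : 0 < P) (hs₂ : 0 ≤ s₂)
    (hu₁ : MemLp (fun ω => g₁ (H ω, Z 0 ω + Z 1 ω)) 2 μ)
    (hX : MemLp (fun ω => a * Z 0 ω + g₁ (H ω, Z 0 ω + Z 1 ω) + g₂ (H ω, Z 0 ω + Z 2 ω)) 2 μ) :
    s₂ / (s₂ + P) * (9 / 10 * a ^ 2 * P - 10 * ∫ ω, g₁ (H ω, Z 0 ω + Z 1 ω) ^ 2 ∂μ) ≤
      ∫ ω, (a * Z 0 ω + g₁ (H ω, Z 0 ω + Z 1 ω) + g₂ (H ω, Z 0 ω + Z 2 ω)) ^ 2 ∂μ := by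
  have := hZ.isProbabilityMeasure
  have hm := hZ.measurable
  set u₁ : Ω → ℝ := fun ω => g₁ (H ω, Z 0 ω + Z 1 ω) with hu₁def
  set u₂ : Ω → ℝ := fun ω => g₂ (H ω, Z 0 ω + Z 2 ω) with hu₂def
  set z : Ω → ℝ := linForm ![s₂, 0, -P, 0] Z with hz
  have hzval : ∀ ω, z ω = s₂ * Z 0 ω - P * Z 2 ω := fun ω => by
    simp [hz, linForm, Fin.sum_univ_four]; ring
  have e0 : linForm ![1, 0, 0, 0] Z = Z 0 := by
    ext ω; simp [linForm, Fin.sum_univ_four]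
  have e2 : linForm ![0, 0, 1, 0] Z = Z 2 := by
    ext ω; simp [linForm, Fin.sum_univ_four]
  have hzL : MemLp z 2 μ := hZ.memLp_linForm _
  have hu₂ : MemLp u₂ 2 μ := by
    convert (hX.sub hu₁).sub ((hZ.memLp 0).const_mul a) using 1
    ext ω
    simp only [Pi.sub_apply, hu₁def, hu₂def]
    ring
  have hzu₂ : ∫ ω, z ω * u₂ ω ∂μ = 0 := by
    have h := hZ.indepFun_linForm hH hHZ (c := ![s₂, 0, -P, 0])
      (d := fun _ : Unit => ![1, 0, 1, 0]) (by intro k; simp [Fin.sum_univ_four]; ring)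
    have hy : ∀ ω, linForm ![1, 0, 1, 0] Z ω = Z 0 ω + Z 2 ω := fun ω => by
      simp [linForm, Fin.sum_univ_four]
    simp only [hy] at h
    have h' : IndepFun z u₂ μ :=
      h.comp (ψ := fun y : α × (Unit → ℝ) => g₂ (y.1, y.2 ())) measurable_id (by fun_prop)
    rw [h'.integral_fun_mul_eq_mul_integral hzL.aestronglyMeasurable hu₂.aestronglyMeasurable,
      hz, hZ.integral_linForm, zero_mul]
  have hvu₁ : ∫ ω, Z 2 ω * u₁ ω ∂μ = 0 := by
    have h := hZ.indepFun_linForm hH hHZ (c := ![0, 0, 1, 0])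
      (d := fun _ : Unit => ![1, 1, 0, 0]) (by intro k; simp [Fin.sum_univ_four])
    have hy : ∀ ω, linForm ![1, 1, 0, 0] Z ω = Z 0 ω + Z 1 ω := fun ω => by
      simp [linForm, Fin.sum_univ_four]
    simp only [hy, e2] at h
    have h' : IndepFun (Z 2) u₁ μ :=
      h.comp (ψ := fun y : α × (Unit → ℝ) => g₁ (y.1, y.2 ())) measurable_id (by fun_prop)
    rw [h'.integral_fun_mul_eq_mul_integral (hZ.memLp 2).aestronglyMeasurable
      hu₁.aestronglyMeasurable, hZ.integral_eq_zero, zero_mul]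
  have hze : ∫ ω, z ω * Z 0 ω ∂μ = s₂ * P := by
    rw [hz, ← e0, hZ.integral_linForm_mul]
    simp [Fin.sum_univ_four]
  have hzz : ∫ ω, z ω ^ 2 ∂μ = s₂ ^ 2 * P + P ^ 2 * s₂ := by
    rw [hz, hZ.integral_linForm_sq]
    simp [Fin.sum_univ_four]
  have hee : ∫ ω, Z 0 ω ^ 2 ∂μ = P := by
    rw [← e0, hZ.integral_linForm_sq]
    simp [Fin.sum_univ_four]
  have hsP : 0 < s₂ + P := by linarith
  set l : ℝ := a / (s₂ + P) with hl
  set k : ℝ := s₂ / (s₂ + P) with hk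
  have hk0 : 0 ≤ k := by positivity
  have i1 : Integrable (fun ω => z ω * Z 0 ω) μ := hzL.integrable_mul (hZ.memLp 0)
  have i2 : Integrable (fun ω => Z 2 ω * u₁ ω) μ := (hZ.memLp 2).integrable_mul hu₁
  have i3 : Integrable (fun ω => z ω * u₂ ω) μ := hzL.integrable_mul hu₂
  have i4 : Integrable (fun ω => z ω ^ 2) μ := hzL.integrable_sq
  have i5 : Integrable (fun ω => Z 0 ω ^ 2) μ := (hZ.memLp 0).integrable_sq
  have i6 : Integrable (fun ω => u₁ ω ^ 2) μ := hu₁.integrable_sq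
  -- Expansion of `(X - l * z) ^ 2 ≥ 0` for the next state `X`; the only product of the first control
  -- that is not uncorrelated, `Z 0 * u₁`, is estimated by squares.
  have hpt : ∀ ω, 2 * l * a * (z ω * Z 0 ω) + (-(2 * l * P)) * (Z 2 ω * u₁ ω)
      + 2 * l * (z ω * u₂ ω) + (-l ^ 2) * z ω ^ 2 + (-(k * a ^ 2 / 10)) * Z 0 ω ^ 2
      + (-(10 * k)) * u₁ ω ^ 2 ≤ (a * Z 0 ω + u₁ ω + u₂ ω) ^ 2 := by
    intro ω
    have h1 := sq_nonneg ((a * Z 0 ω + u₁ ω + u₂ ω) - l * z ω)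
    have h2 : 0 ≤ k / 10 * (a * Z 0 ω + 10 * u₁ ω) ^ 2 := by positivity
    have h3 : l * s₂ = a * k := by rw [hl, hk]; ring
    have h4 : l * (z ω * u₁ ω) = a * k * (Z 0 ω * u₁ ω) - l * P * (Z 2 ω * u₁ ω) := by
      rw [hzval, ← h3]; ring
    nlinarith
  have hint := integral_mono (((((((i1.const_mul (2 * l * a)).add (i2.const_mul (-(2 * l * P)))).add
    (i3.const_mul (2 * l))).add (i4.const_mul (-l ^ 2))).add
    (i5.const_mul (-(k * a ^ 2 / 10)))).add (i6.const_mul (-(10 * k))))) hX.integrable_sq hpt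
  refine le_trans (le_of_eq ?_) hint
  rw [integral_add', integral_add', integral_add', integral_add', integral_add']
  · simp only [integral_const_mul, hzu₂, hvu₁, hze, hzz, hee]
    rw [hl, hk]
    field_simp
    ring
  all_goals fun_prop (disch := assumption)

/-- If the power of the first control is small, the next state has a second moment of order at least
`s₂`, whatever the second control does. The constant `3 / 13` is a lower bound of `P / (s₂ + P)`. -/
theorem le_lintegral_sq_of_small_first_control (a : ℝ)
    (hZ : IsGaussianNoise Z ![P, s₁, s₂, 1] μ)
    (hH : Measurable H) (hHZ : IndepFun H (fun ω i => Z i ω) μ) {g₁ g₂ : α × ℝ → ℝ}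
    (hg₁ : Measurable g₁) (hg₂ : Measurable g₂) {m : ℝ} (hm : 0 < m) (hP : 3 / 10 * m ≤ P)
    (hs₂ : 0 ≤ s₂) (hs₂m : s₂ ≤ m) :
    ENNReal.ofReal (27 / 130 * a ^ 2 * s₂) ≤
      ∫⁻ ω, ENNReal.ofReal
        ((a * Z 0 ω + g₁ (H ω, Z 0 ω + Z 1 ω) + g₂ (H ω, Z 0 ω + Z 2 ω)) ^ 2) ∂μ +
      ENNReal.ofReal (100 / 13 * s₂ / m) *
        ∫⁻ ω, ENNReal.ofReal (g₁ (H ω, Z 0 ω + Z 1 ω) ^ 2) ∂μ := by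
  have hmeas := hZ.measurable
  rcases hs₂.eq_or_lt with rfl | hs₂'
  · simp
  have hP0 : 0 < P := by linarith
  have hm₁ : Measurable fun ω => g₁ (H ω, Z 0 ω + Z 1 ω) := by fun_prop
  have hm₂ : Measurable fun ω =>
    a * Z 0 ω + g₁ (H ω, Z 0 ω + Z 1 ω) + g₂ (H ω, Z 0 ω + Z 2 ω) := by fun_prop
  have hK : 0 < 100 / 13 * s₂ / m := by positivity
  by_cases hX : ∫⁻ ω, ENNReal.ofReal
      ((a * Z 0 ω + g₁ (H ω, Z 0 ω + Z 1 ω) + g₂ (H ω, Z 0 ω + Z 2 ω)) ^ 2) ∂μ = ∞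
  · simp [hX]
  by_cases hu : ∫⁻ ω, ENNReal.ofReal (g₁ (H ω, Z 0 ω + Z 1 ω) ^ 2) ∂μ = ∞
  · rw [hu, ENNReal.mul_top (by simpa using hK)]
    simp
  have hXi := (lintegral_ofReal_ne_top_iff_integrable (hm₂.pow_const 2).aestronglyMeasurable
    (ae_of_all _ fun ω => sq_nonneg _)).1 hX
  have hui := (lintegral_ofReal_ne_top_iff_integrable (hm₁.pow_const 2).aestronglyMeasurable
    (ae_of_all _ fun ω => sq_nonneg _)).1 hu
  have hXL := (memLp_two_iff_integrable_sq hm₂.aestronglyMeasurable).2 hXi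
  have huL := (memLp_two_iff_integrable_sq hm₁.aestronglyMeasurable).2 hui
  have key := le_integral_sq_of_small_first_control a hZ hH hHZ hg₁ hg₂ hP0 hs₂ huL hXL
  rw [← ofReal_integral_eq_lintegral_ofReal hXi (ae_of_all _ fun ω => sq_nonneg _),
    ← ofReal_integral_eq_lintegral_ofReal hui (ae_of_all _ fun ω => sq_nonneg _),
    ← ENNReal.ofReal_mul hK.le, ← ENNReal.ofReal_add (integral_nonneg fun ω => sq_nonneg _)
      (mul_nonneg hK.le (integral_nonneg fun ω => sq_nonneg _))]
  refine ENNReal.ofReal_le_ofReal ?_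
  have hX0 : 0 ≤ ∫ ω, (a * Z 0 ω + g₁ (H ω, Z 0 ω + Z 1 ω) + g₂ (H ω, Z 0 ω + Z 2 ω)) ^ 2 ∂μ :=
    integral_nonneg fun ω => sq_nonneg _
  have hU0 : 0 ≤ ∫ ω, g₁ (H ω, Z 0 ω + Z 1 ω) ^ 2 ∂μ := integral_nonneg fun ω => sq_nonneg _
  generalize ∫ ω, (a * Z 0 ω + g₁ (H ω, Z 0 ω + Z 1 ω) + g₂ (H ω, Z 0 ω + Z 2 ω)) ^ 2 ∂μ = E at *
  generalize ∫ ω, g₁ (H ω, Z 0 ω + Z 1 ω) ^ 2 ∂μ = U at *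
  have hd : 27 / 130 * a ^ 2 * s₂ - 100 / 13 * s₂ / m * U =
      s₂ * (3 / 13) * (9 / 10 * a ^ 2 - 100 / 3 * U / m) := by
    field_simp
    ring
  suffices h : s₂ * (3 / 13) * (9 / 10 * a ^ 2 - 100 / 3 * U / m) ≤ E by linarith
  rcases le_total (9 / 10 * a ^ 2 - 100 / 3 * U / m) 0 with hneg | hpos
  · exact (mul_nonpos_of_nonneg_of_nonpos (by positivity) hneg).trans hX0
  · refine le_trans ?_ key
    have h1 : s₂ * (3 / 13) ≤ s₂ / (s₂ + P) * P := by
      rw [div_mul_eq_mul_div, le_div_iff₀ (by linarith)]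
      nlinarith
    have h2 : P * (9 / 10 * a ^ 2 - 100 / 3 * U / m) ≤ 9 / 10 * a ^ 2 * P - 10 * U := by
      have : 10 * U ≤ P * (100 / 3 * U / m) := by
        rw [← mul_div_assoc, le_div_iff₀ hm]
        nlinarith
      linarith
    calc _ ≤ s₂ / (s₂ + P) * P * (9 / 10 * a ^ 2 - 100 / 3 * U / m) := by gcongr
      _ = s₂ / (s₂ + P) * (P * (9 / 10 * a ^ 2 - 100 / 3 * U / m)) := by ring
      _ ≤ _ := by gcongr

end Stage

/-! ### The primitive random variables and the innovation of the state -/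

section ClosedLoop

variable {σ₀ σ₁ σ₂ : ℝ≥0}

instance isProbabilityMeasure_noiseLaw : IsProbabilityMeasure (noiseLaw σ₀ σ₁ σ₂) := by
  unfold noiseLaw
  infer_instance

theorem iIndepFun_noiseLaw :
    iIndepFun (fun (i : NoiseIndex) (ω : NoiseIndex → ℝ) => ω i) (noiseLaw σ₀ σ₁ σ₂) :=
  iIndepFun_infinitePi (X := fun _ x => x) fun _ => measurable_id

theorem hasLaw_noiseLaw_eval (i : NoiseIndex) :
    HasLaw (fun ω : NoiseIndex → ℝ => ω i) (gaussianReal 0 (noiseVariance σ₀ σ₁ σ₂ i))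
      (noiseLaw σ₀ σ₁ σ₂) :=
  ⟨(measurable_pi_apply i).aemeasurable, Measure.infinitePi_map_eval _ i⟩

theorem hasGaussianLaw_noiseLaw_eval (i : NoiseIndex) :
    HasGaussianLaw (fun ω : NoiseIndex → ℝ => ω i) (noiseLaw σ₀ σ₁ σ₂) :=
  (hasLaw_noiseLaw_eval i).hasGaussianLaw

theorem integral_noiseLaw_eval (i : NoiseIndex) : ∫ ω, ω i ∂(noiseLaw σ₀ σ₁ σ₂) = 0 := by
  rw [(hasLaw_noiseLaw_eval i).integral_eq, integral_id_gaussianReal]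

theorem variance_noiseLaw_eval (i : NoiseIndex) :
    Var[fun ω => ω i; noiseLaw σ₀ σ₁ σ₂] = noiseVariance σ₀ σ₁ σ₂ i := by
  rw [(hasLaw_noiseLaw_eval i).variance_eq, variance_id_gaussianReal]

/-- The labels of the initial state and of the disturbances and observation noises of the times
before `n`; these determine the state at time `n` and all earlier observations. -/
def pastNoise (n : ℕ) : Set NoiseIndex :=
  {i | match i with
    | .init => True
    | .dist k => k < n
    | .obs₁ k => k < n
    | .obs₂ k => k < n}

/-- The σ-algebra generated by the initial state and all noises of the times before `n`. -/
abbrev pastSigma (n : ℕ) : MeasurableSpace (NoiseIndex → ℝ) :=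
  ⨆ i ∈ pastNoise n, MeasurableSpace.comap (fun ω : NoiseIndex → ℝ => ω i) inferInstance

theorem pastSigma_le (n : ℕ) : pastSigma n ≤ MeasurableSpace.pi :=
  iSup₂_le fun i _ => (measurable_pi_apply i).comap_le

theorem pastSigma_mono : Monotone pastSigma := by
  intro m n hmn
  refine biSup_mono fun i hi => ?_
  cases i with
  | init => trivial
  | dist k => exact lt_of_lt_of_le (show k < m from hi) hmn
  | obs₁ k => exact lt_of_lt_of_le (show k < m from hi) hmn
  | obs₂ k => exact lt_of_lt_of_le (show k < m from hi) hmn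

theorem measurable_pastSigma_eval {n : ℕ} {i : NoiseIndex} (hi : i ∈ pastNoise n) :
    Measurable[pastSigma n] fun ω : NoiseIndex → ℝ => ω i :=
  measurable_iff_comap_le.2 (le_iSup₂_of_le i hi le_rfl)

theorem measurable_pastSigma_of_le {β : Type*} [MeasurableSpace β] {m n : ℕ} (h : m ≤ n)
    {X : (NoiseIndex → ℝ) → β} (hX : Measurable[pastSigma m] X) : Measurable[pastSigma n] X :=
  hX.mono (pastSigma_mono h) le_rfl

/-- The noises of time `n`. -/
def presentIndex (n : ℕ) : Fin 3 → NoiseIndex := ![.obs₁ n, .obs₂ n, .dist n]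

theorem presentIndex_injective (n : ℕ) : Function.Injective (presentIndex n) := by
  intro i j h
  fin_cases i <;> fin_cases j <;> simp_all [presentIndex]

/-- The noises of time `n` are independent of the past. -/
theorem indepFun_present {β : Type*} [MeasurableSpace β] {n : ℕ} {X : (NoiseIndex → ℝ) → β}
    (hX : Measurable[pastSigma n] X) :
    IndepFun X (fun ω i => ω (presentIndex n i)) (noiseLaw σ₀ σ₁ σ₂) := by
  have hdisj : Disjoint (pastNoise n) (Set.range (presentIndex n)) := by
    rw [Set.disjoint_left]
    rintro _ hi ⟨j, rfl⟩
    fin_cases j <;> exact lt_irrefl n hi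
  have h := indep_iSup_of_disjoint (fun i => (measurable_pi_apply i).comap_le)
    (iIndepFun_noiseLaw (σ₀ := σ₀) (σ₁ := σ₁) (σ₂ := σ₂)) hdisj
  rw [IndepFun_iff_Indep]
  refine indep_of_indep_of_le h (measurable_iff_comap_le.1 hX) ?_
  rw [← measurable_iff_comap_le, @measurable_pi_iff]
  intro j
  exact measurable_iff_comap_le.2 (le_iSup₂_of_le (presentIndex n j) ⟨j, rfl⟩ le_rfl)

variable (a : ℝ) (f₁ f₂ : CausalStrategy)

theorem measurable_pastSigma_state (n : ℕ) :
    Measurable[pastSigma n] fun ω => state a f₁ f₂ ω n := by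
  induction n using Nat.strong_induction_on with
  | _ n ih =>
    cases n with
    | zero =>
      simp only [state]
      exact measurable_pastSigma_eval trivial
    | succ n =>
      simp only [state]
      have hx : ∀ k ≤ n, Measurable[pastSigma (n + 1)] fun ω => state a f₁ f₂ ω k := fun k hk =>
        measurable_pastSigma_of_le (by omega) (ih k (by omega))
      have hy₁ : Measurable[pastSigma (n + 1)] fun ω (k : Fin (n + 1)) =>
          state a f₁ f₂ ω k.1 + ω (.obs₁ k.1) :=
        @measurable_pi_lambda _ _ _ (pastSigma (n + 1)) _ _ fun k =>
          (hx k.1 (by omega)).add (measurable_pastSigma_eval k.2)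
      have hy₂ : Measurable[pastSigma (n + 1)] fun ω (k : Fin (n + 1)) =>
          state a f₁ f₂ ω k.1 + ω (.obs₂ k.1) :=
        @measurable_pi_lambda _ _ _ (pastSigma (n + 1)) _ _ fun k =>
          (hx k.1 (by omega)).add (measurable_pastSigma_eval k.2)
      exact ((((hx n le_rfl).const_mul a).add ((f₁.measurable_toFun n).comp hy₁)).add
        ((f₂.measurable_toFun n).comp hy₂)).add (measurable_pastSigma_eval (Nat.lt_succ_self n))

theorem measurable_state (n : ℕ) : Measurable fun ω => state a f₁ f₂ ω n :=
  (measurable_pastSigma_state a f₁ f₂ n).mono (pastSigma_le n) le_rfl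

theorem measurable_input₁ (n : ℕ) : Measurable fun ω => input₁ a f₁ f₂ ω n := by
  have := measurable_state a f₁ f₂
  exact (f₁.measurable_toFun n).comp (by fun_prop)

theorem measurable_input₂ (n : ℕ) : Measurable fun ω => input₂ a f₁ f₂ ω n := by
  have := measurable_state a f₁ f₂
  exact (f₂.measurable_toFun n).comp (by fun_prop)

/-- The observations of both controllers at the times before `n`, extended by zero. -/
noncomputable def history (n : ℕ) (ω : NoiseIndex → ℝ) (k : ℕ) : ℝ × ℝ :=
  if k < n then (state a f₁ f₂ ω k + ω (.obs₁ k), state a f₁ f₂ ω k + ω (.obs₂ k)) else 0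

theorem measurable_pastSigma_history (n : ℕ) : Measurable[pastSigma n] (history a f₁ f₂ n) := by
  rw [@measurable_pi_iff]
  intro k
  by_cases hk : k < n
  · simp only [history, hk, if_true]
    have hx := measurable_pastSigma_of_le hk.le (measurable_pastSigma_state a f₁ f₂ k)
    exact (hx.add (measurable_pastSigma_eval hk)).prodMk (hx.add (measurable_pastSigma_eval hk))
  · simp only [history, hk, if_false]
    exact measurable_const

theorem measurable_history (n : ℕ) : Measurable (history a f₁ f₂ n) :=
  (measurable_pastSigma_history a f₁ f₂ n).mono (pastSigma_le n) le_rfl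

theorem history_succ (n : ℕ) (ω : NoiseIndex → ℝ) :
    history a f₁ f₂ (n + 1) ω = Function.update (history a f₁ f₂ n ω) n
      (state a f₁ f₂ ω n + ω (.obs₁ n), state a f₁ f₂ ω n + ω (.obs₂ n)) := by
  funext k
  rcases lt_trichotomy k n with hk | rfl | hk
  · simp [history, hk, hk.ne, Nat.lt_succ_of_lt hk]
  · simp [history]
  · have h1 : ¬ k < n + 1 := by omega
    have h2 : ¬ k < n := by omega
    simp [history, hk.ne', h1, h2]

/-- The input of the first controller as a function of the history before `n` and of its own
observation at time `n`. -/
noncomputable def inputOfHistory₁ (n : ℕ) (p : (ℕ → ℝ × ℝ) × ℝ) : ℝ :=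
  f₁.toFun n fun k => if k.1 < n then (p.1 k.1).1 else p.2

/-- The input of the second controller as a function of the history before `n` and of its own
observation at time `n`. -/
noncomputable def inputOfHistory₂ (n : ℕ) (p : (ℕ → ℝ × ℝ) × ℝ) : ℝ :=
  f₂.toFun n fun k => if k.1 < n then (p.1 k.1).2 else p.2

theorem measurable_inputOfHistory₁ (n : ℕ) : Measurable (inputOfHistory₁ f₁ n) := by
  refine (f₁.measurable_toFun n).comp (measurable_pi_lambda _ fun k => ?_)
  split_ifs <;> fun_prop

theorem measurable_inputOfHistory₂ (n : ℕ) : Measurable (inputOfHistory₂ f₂ n) := by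
  refine (f₂.measurable_toFun n).comp (measurable_pi_lambda _ fun k => ?_)
  split_ifs <;> fun_prop

theorem input₁_eq (n : ℕ) (ω : NoiseIndex → ℝ) : input₁ a f₁ f₂ ω n =
    inputOfHistory₁ f₁ n (history a f₁ f₂ n ω, state a f₁ f₂ ω n + ω (.obs₁ n)) := by
  unfold input₁ inputOfHistory₁
  congr 1
  funext k
  by_cases hk : k.1 < n
  · simp [history, hk]
  · have : k.1 = n := by omega
    simp [this]

theorem input₂_eq (n : ℕ) (ω : NoiseIndex → ℝ) : input₂ a f₁ f₂ ω n =
    inputOfHistory₂ f₂ n (history a f₁ f₂ n ω, state a f₁ f₂ ω n + ω (.obs₂ n)) := by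
  unfold input₂ inputOfHistory₂
  congr 1
  funext k
  by_cases hk : k.1 < n
  · simp [history, hk]
  · have : k.1 = n := by omega
    simp [this]

theorem state_succ (n : ℕ) (ω : NoiseIndex → ℝ) : state a f₁ f₂ ω (n + 1) =
    a * state a f₁ f₂ ω n + input₁ a f₁ f₂ ω n + input₂ a f₁ f₂ ω n + ω (.dist n) := by
  rw [state]
  rfl

/-- The random variable `e` of variance `P` is the innovation of the state at time `n`: it is
centred Gaussian, independent of the history, and the rest `φ` of the state is known to a
controller which knows the history. -/
structure IsInnovation (σ₀ σ₁ σ₂ : ℝ≥0) (n : ℕ) (e : (NoiseIndex → ℝ) → ℝ)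
    (φ : (ℕ → ℝ × ℝ) → ℝ) (P : ℝ) : Prop where
  measurable : Measurable[pastSigma n] e
  hasGaussianLaw : HasGaussianLaw e (noiseLaw σ₀ σ₁ σ₂)
  integral_eq_zero : ∫ ω, e ω ∂(noiseLaw σ₀ σ₁ σ₂) = 0
  variance_eq : Var[e; noiseLaw σ₀ σ₁ σ₂] = P
  measurable_rest : Measurable φ
  indepFun : IndepFun (history a f₁ f₂ n) e (noiseLaw σ₀ σ₁ σ₂)
  state_eq : ∀ ω, state a f₁ f₂ ω n = e ω + φ (history a f₁ f₂ n ω)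

/-- The innovation of the state at time `n` and the three noises of that time. -/
def stageNoise (n : ℕ) (e : (NoiseIndex → ℝ) → ℝ) : Fin 4 → (NoiseIndex → ℝ) → ℝ :=
  ![e, fun ω => ω (.obs₁ n), fun ω => ω (.obs₂ n), fun ω => ω (.dist n)]

namespace IsInnovation

variable {a f₁ f₂} {n : ℕ} {e : (NoiseIndex → ℝ) → ℝ} {φ : (ℕ → ℝ × ℝ) → ℝ} {P : ℝ}

theorem measurable_pi (h : IsInnovation a f₁ f₂ σ₀ σ₁ σ₂ n e φ P) : Measurable e :=
  h.measurable.mono (pastSigma_le n) le_rfl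

theorem isGaussianNoise (h : IsInnovation a f₁ f₂ σ₀ σ₁ σ₂ n e φ P) :
    IsGaussianNoise (stageNoise n e) ![P, (σ₁ : ℝ) ^ 2, (σ₂ : ℝ) ^ 2, 1]
      (noiseLaw σ₀ σ₁ σ₂) := by
  have heV := indepFun_present (σ₀ := σ₀) (σ₁ := σ₁) (σ₂ := σ₂) h.measurable
  have hpair := (iIndepFun_noiseLaw (σ₀ := σ₀) (σ₁ := σ₁) (σ₂ := σ₂)).precomp
    (presentIndex_injective n)
  have hV : HasGaussianLaw (fun (ω : NoiseIndex → ℝ) i => ω (presentIndex n i))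
      (noiseLaw σ₀ σ₁ σ₂) :=
    iIndepFun.hasGaussianLaw (fun i => hasGaussianLaw_noiseLaw_eval _) hpair
  have hsucc : ∀ j : Fin 3, stageNoise n e j.succ = fun ω => ω (presentIndex n j) := by
    intro j
    fin_cases j <;> rfl
  have hsuccVar : ∀ j : Fin 3, (![P, (σ₁ : ℝ) ^ 2, (σ₂ : ℝ) ^ 2, 1] : Fin 4 → ℝ) j.succ =
      noiseVariance σ₀ σ₁ σ₂ (presentIndex n j) := by
    intro j
    fin_cases j <;> simp [noiseVariance, presentIndex]
  have hLp : ∀ j, MemLp (fun ω : NoiseIndex → ℝ => ω (presentIndex n j)) 2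
    (noiseLaw σ₀ σ₁ σ₂) := fun j => (hasGaussianLaw_noiseLaw_eval _).memLp_two
  have h0 : stageNoise n e 0 = e := rfl
  have hcov0 : ∀ j : Fin 3,
      cov[e, fun ω => ω (presentIndex n j); noiseLaw σ₀ σ₁ σ₂] = 0 := fun j =>
    (heV.comp measurable_id (measurable_pi_apply j)).covariance_eq_zero
      h.hasGaussianLaw.memLp_two (hLp j)
  refine ⟨fun i => ?_, ?_, fun i => ?_, fun i j => ?_⟩
  · refine Fin.cases ?_ (fun j => ?_) i
    · exact h.measurable_pi
    · rw [hsucc]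
      exact measurable_pi_apply _
  · let L : ℝ × (Fin 3 → ℝ) →L[ℝ] (Fin 4 → ℝ) := ContinuousLinearMap.pi
      ![ContinuousLinearMap.fst ℝ ℝ (Fin 3 → ℝ),
        (ContinuousLinearMap.proj 0).comp (ContinuousLinearMap.snd ℝ ℝ (Fin 3 → ℝ)),
        (ContinuousLinearMap.proj 1).comp (ContinuousLinearMap.snd ℝ ℝ (Fin 3 → ℝ)),
        (ContinuousLinearMap.proj 2).comp (ContinuousLinearMap.snd ℝ ℝ (Fin 3 → ℝ))]
    have hL : (fun ω i => stageNoise n e i ω) =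
        fun ω => L (e ω, fun i => ω (presentIndex n i)) := by
      funext ω i
      fin_cases i <;> rfl
    rw [hL]
    exact (heV.hasGaussianLaw h.hasGaussianLaw hV).map_fun L
  · refine Fin.cases ?_ (fun j => ?_) i
    · exact h.integral_eq_zero
    · rw [hsucc]
      exact integral_noiseLaw_eval _
  · refine Fin.cases ?_ (fun i => ?_) i <;> refine Fin.cases ?_ (fun j => ?_) j
    · rw [h0, covariance_self h.measurable_pi.aemeasurable, h.variance_eq]
      rfl
    · rw [h0, hsucc, hcov0, if_neg (Fin.succ_ne_zero j).symm]
    · rw [h0, hsucc, covariance_comm, hcov0, if_neg (Fin.succ_ne_zero i)]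
    · rw [hsucc, hsucc]
      by_cases hij : i = j
      · subst hij
        rw [if_pos rfl, hsuccVar, covariance_self (measurable_pi_apply _).aemeasurable,
          variance_noiseLaw_eval]
      · rw [if_neg (by simpa using hij)]
        exact (hpair.indepFun hij).covariance_eq_zero (hLp i) (hLp j)

theorem indepFun_stageNoise (h : IsInnovation a f₁ f₂ σ₀ σ₁ σ₂ n e φ P) :
    IndepFun (history a f₁ f₂ n) (fun ω i => stageNoise n e i ω) (noiseLaw σ₀ σ₁ σ₂) := by
  have hV := indepFun_present (σ₀ := σ₀) (σ₁ := σ₁) (σ₂ := σ₂)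
    ((measurable_pastSigma_history a f₁ f₂ n).prodMk h.measurable)
  have h1 := indepFun_prodMk_of_indepFun_prodMk (measurable_history a f₁ f₂ n) h.measurable_pi
    (measurable_pi_lambda _ fun i => measurable_pi_apply _) h.indepFun hV
  refine h1.comp (ψ := fun p : ℝ × (Fin 3 → ℝ) => (![p.1, p.2 0, p.2 1, p.2 2] : Fin 4 → ℝ))
    measurable_id (measurable_pi_lambda _ fun i => ?_) |>.congr .rfl (ae_of_all _ fun ω => ?_)
  · fin_cases i <;> simp <;> fun_prop
  · funext i
    fin_cases i <;> rfl

end IsInnovation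

end ClosedLoop

/-! ### Lower bounds of the second moments of the state -/

section StateBounds

variable {σ₀ σ₁ σ₂ : ℝ≥0}

/-- Growth of the innovation variance from `P` to `a ^ 2 * (c * P) + 1`, where `c * P` is the
estimation error: below the level `3 / 10 * a ^ 2 * s` it grows by at least one per step. -/
theorem le_sq_mul_error_variance {a s P M c : ℝ} (ha : 25 / 4 ≤ a ^ 2) (hs : 0 ≤ s)
    (hM : 0 ≤ M) (hMP : M ≤ P) (hMs : M ≤ 3 / 10 * (a ^ 2 * s)) (hc : s * P ≤ c * P * (s + 2 * P)) :
    M ≤ a ^ 2 * (c * P) := by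
  have hP : 0 ≤ P := hM.trans hMP
  rcases hP.eq_or_lt with rfl | hP'
  · simpa using hMP
  have h1 : 0 < s + 2 * P := by linarith
  have h2 : M * (s + 2 * P) ≤ a ^ 2 * (s * P) := by
    nlinarith [mul_nonneg hs hP, mul_le_mul_of_nonneg_right hMs hP,
      mul_le_mul_of_nonneg_right hMP hs]
  refine le_of_mul_le_mul_right (h2.trans ?_) h1
  nlinarith [mul_le_mul_of_nonneg_left hc (sq_nonneg a)]

/-- One step of the Kalman recursion: the innovation at time `n + 1` is `a` times the error of the
best linear estimate of the innovation at time `n`, plus the disturbance. -/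
theorem IsInnovation.exists_succ {a : ℝ} {f₁ f₂ : CausalStrategy} {n : ℕ}
    {e : (NoiseIndex → ℝ) → ℝ} {φ : (ℕ → ℝ × ℝ) → ℝ} {P l₁ l₂ : ℝ}
    (h : IsInnovation a f₁ f₂ σ₀ σ₁ σ₂ n e φ P)
    (hl₁ : (1 - l₁ - l₂) * P = l₁ * (σ₁ : ℝ) ^ 2) (hl₂ : (1 - l₁ - l₂) * P = l₂ * (σ₂ : ℝ) ^ 2) :
    ∃ e' φ', IsInnovation a f₁ f₂ σ₀ σ₁ σ₂ (n + 1) e' φ' (a ^ 2 * ((1 - l₁ - l₂) * P) + 1) := by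
  have hZ := h.isGaussianNoise
  have hHZ := h.indepFun_stageNoise
  have hφ := h.measurable_rest
  have hH := measurable_history a f₁ f₂ n
  have hg₁ := measurable_inputOfHistory₁ f₁ n
  have hg₂ := measurable_inputOfHistory₂ f₂ n
  set c : Fin 4 → ℝ := ![a * (1 - l₁ - l₂), -(a * l₁), -(a * l₂), 1] with hc
  set r : (ℕ → ℝ × ℝ) → ℕ → ℝ × ℝ := fun p k => if k < n then p k else 0 with hr
  have hrm : Measurable r := measurable_pi_lambda _ fun k => by
    simp only [hr]
    split_ifs <;> fun_prop
  have hval : ∀ ω, linForm c (stageNoise n e) ω = a * (1 - l₁ - l₂) * e ω - a * l₁ * ω (.obs₁ n)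
      - a * l₂ * ω (.obs₂ n) + ω (.dist n) := fun ω => by
    simp [linForm, Fin.sum_univ_four, stageNoise, hc]
    ring
  refine ⟨linForm c (stageNoise n e), fun p => a * φ (r p) + a * l₁ * ((p n).1 - φ (r p))
    + a * l₂ * ((p n).2 - φ (r p)) + inputOfHistory₁ f₁ n (r p, (p n).1)
    + inputOfHistory₂ f₂ n (r p, (p n).2), ?_, hZ.hasGaussianLaw_linForm c, hZ.integral_linForm c,
    ?_, by fun_prop, ?_, fun ω => ?_⟩
  · have he := measurable_pastSigma_of_le n.le_succ h.measurable
    have h1 : Measurable[pastSigma (n + 1)] fun ω : NoiseIndex → ℝ => ω (.obs₁ n) :=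
      measurable_pastSigma_eval n.lt_succ_self
    have h2 : Measurable[pastSigma (n + 1)] fun ω : NoiseIndex → ℝ => ω (.obs₂ n) :=
      measurable_pastSigma_eval n.lt_succ_self
    have h3 : Measurable[pastSigma (n + 1)] fun ω : NoiseIndex → ℝ => ω (.dist n) :=
      measurable_pastSigma_eval n.lt_succ_self
    rw [funext hval]
    exact (((he.const_mul _).sub (h1.const_mul _)).sub (h2.const_mul _)).add h3
  · rw [← covariance_self (hZ.measurable_linForm c).aemeasurable, hZ.covariance_linForm]
    simp only [hc, Fin.sum_univ_four, Matrix.cons_val]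
    linear_combination (-(a ^ 2 * l₁)) * hl₁ + (-(a ^ 2 * l₂)) * hl₂
  · have hind := hZ.indepFun_linForm hH hHZ (c := c) (d := ![![1, 1, 0, 0], ![1, 0, 1, 0]]) (by
      intro k
      fin_cases k
      · simp [Fin.sum_univ_four, hc]
        linear_combination a * hl₁
      · simp [Fin.sum_univ_four, hc]
        linear_combination a * hl₂)
    have hψ : Measurable fun p : (ℕ → ℝ × ℝ) × (Fin 2 → ℝ) =>
        Function.update p.1 n (p.2 0 + φ p.1, p.2 1 + φ p.1) := by
      refine measurable_pi_lambda _ fun k => ?_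
      by_cases hk : k = n
      · subst hk
        simp only [Function.update_self]
        fun_prop
      · simp only [Function.update_of_ne hk]
        fun_prop
    refine (hind.comp measurable_id hψ).symm.congr (ae_of_all _ fun ω => ?_) .rfl
    simp only [Function.comp_apply, history_succ, h.state_eq]
    congr 2 <;> simp [linForm, Fin.sum_univ_four, stageNoise] <;> ring
  · have hrH : r (history a f₁ f₂ (n + 1) ω) = history a f₁ f₂ n ω := by
      funext k
      by_cases hk : k < n
      · simp [hr, history, hk, Nat.lt_succ_of_lt hk]
      · simp [hr, history, hk]
    have hn : history a f₁ f₂ (n + 1) ω n =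
        (state a f₁ f₂ ω n + ω (.obs₁ n), state a f₁ f₂ ω n + ω (.obs₂ n)) := by
      simp [history]
    rw [hrH, hn, state_succ, input₁_eq, input₂_eq, hval]
    simp only [h.state_eq]
    ring

theorem exists_isInnovation {a : ℝ} (ha : 25 / 4 ≤ a ^ 2) (hσ : σ₁ ≤ σ₂) (f₁ f₂ : CausalStrategy)
    (n : ℕ) : ∃ e φ P, IsInnovation a f₁ f₂ σ₀ σ₁ σ₂ n e φ P ∧
      min (n : ℝ) (3 / 10 * max 1 (a ^ 2 * (σ₁ : ℝ) ^ 2)) ≤ P := by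
  induction n with
  | zero =>
    refine ⟨fun ω => ω .init, fun _ => 0, (σ₀ : ℝ) ^ 2,
      ⟨measurable_pastSigma_eval trivial, hasGaussianLaw_noiseLaw_eval _,
        integral_noiseLaw_eval _, ?_, measurable_const, ?_, fun ω => ?_⟩, ?_⟩
    · rw [variance_noiseLaw_eval]
      simp [noiseVariance]
    · have : history a f₁ f₂ 0 = fun _ => 0 := by
        funext ω k
        simp [history]
      rw [this]
      exact indepFun_const_left _ _
    · simp [state]
    · exact (min_le_left _ _).trans (by simp)
  | succ n ih =>
    obtain ⟨e, φ, P, h, hP⟩ := ih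
    have hM : 0 ≤ min (n : ℝ) (3 / 10 * max 1 (a ^ 2 * (σ₁ : ℝ) ^ 2)) := by positivity
    have hσ' : (σ₁ : ℝ) ^ 2 ≤ (σ₂ : ℝ) ^ 2 := by gcongr
    obtain ⟨l₁, l₂, hl₁, hl₂, hl⟩ := exists_estimator_gains (hM.trans hP) (sq_nonneg (σ₁ : ℝ)) hσ'
    obtain ⟨e', φ', h'⟩ := h.exists_succ hl₁ hl₂
    refine ⟨e', φ', _, h', ?_⟩
    rcases le_total (a ^ 2 * (σ₁ : ℝ) ^ 2) 1 with ht | ht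
    · have := le_sq_mul_error_variance (M := 0) ha (sq_nonneg (σ₁ : ℝ)) le_rfl (hM.trans hP)
        (by positivity) hl
      refine (min_le_right _ _).trans ?_
      rw [max_eq_left ht]
      linarith
    · rw [max_eq_right ht] at hP hM ⊢
      have := le_sq_mul_error_variance ha (sq_nonneg (σ₁ : ℝ)) hM hP (min_le_right _ _) hl
      refine le_trans ?_ (add_le_add_left this 1)
      rw [← min_add_add_right]
      push_cast
      exact min_le_min le_rfl (by linarith)

variable (a : ℝ) (f₁ f₂ : CausalStrategy)

/-- No strategies can make the state smaller than its innovation. -/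
theorem le_secondMoment_state (ha : 25 / 4 ≤ a ^ 2) (hσ : σ₁ ≤ σ₂) {n : ℕ}
    (hnT : 3 / 10 * max 1 (a ^ 2 * (σ₁ : ℝ) ^ 2) ≤ n) :
    ENNReal.ofReal (3 / 10 * max 1 (a ^ 2 * (σ₁ : ℝ) ^ 2)) ≤
      secondMoment (noiseLaw σ₀ σ₁ σ₂) (fun ω => state a f₁ f₂ ω n) := by
  obtain ⟨e, φ, P, h, hP⟩ := exists_isInnovation (σ₀ := σ₀) ha hσ f₁ f₂ n
  rw [min_eq_right hnT] at hP
  have hφ := h.measurable_rest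
  have hH := measurable_history a f₁ f₂ n
  have key := le_lintegral_add_sq_of_indepFun h.hasGaussianLaw.memLp_two h.integral_eq_zero
    (hφ.comp hH) (h.indepFun.symm.comp measurable_id hφ)
  have hvar : ∫ ω, e ω ^ 2 ∂(noiseLaw σ₀ σ₁ σ₂) = P := by
    rw [← h.variance_eq,
      variance_of_integral_eq_zero h.measurable_pi.aemeasurable h.integral_eq_zero]
  unfold secondMoment
  simp only [h.state_eq]
  refine (ENNReal.ofReal_le_ofReal hP).trans (le_trans ?_ key)
  rw [hvar]
  exact le_self_add

/-- The unit variance of the disturbance adds to the second moment of the controlled state. -/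
theorem one_add_secondMoment_le (ha : 25 / 4 ≤ a ^ 2) (hσ : σ₁ ≤ σ₂) (n : ℕ) :
    1 + secondMoment (noiseLaw σ₀ σ₁ σ₂)
        (fun ω => a * state a f₁ f₂ ω n + input₁ a f₁ f₂ ω n + input₂ a f₁ f₂ ω n) ≤
      secondMoment (noiseLaw σ₀ σ₁ σ₂) (fun ω => state a f₁ f₂ ω (n + 1)) := by
  obtain ⟨e, φ, P, h, -⟩ := exists_isInnovation (σ₀ := σ₀) ha hσ f₁ f₂ n
  have hφ := h.measurable_rest
  have hi₁ := measurable_inputOfHistory₁ f₁ n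
  have hi₂ := measurable_inputOfHistory₂ f₂ n
  have hw := one_add_lintegral_sq_le h.isGaussianNoise (measurable_history a f₁ f₂ n)
    h.indepFun_stageNoise
    (g := fun p => a * (p.2 0 + φ p.1) + inputOfHistory₁ f₁ n (p.1, p.2 0 + φ p.1 + p.2 1)
      + inputOfHistory₂ f₂ n (p.1, p.2 0 + φ p.1 + p.2 2)) (by fun_prop)
  unfold secondMoment
  simp only [state_succ, input₁_eq, input₂_eq, h.state_eq]
  exact hw

/-- While the first controller spends little power, the state stays of the order of the observation
noise of the second controller. -/
theorem le_secondMoment_state_succ_add (ha : 25 / 4 ≤ a ^ 2) (hσ : σ₁ ≤ σ₂)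
    (hweak : (σ₂ : ℝ) ^ 2 ≤ max 1 (a ^ 2 * (σ₁ : ℝ) ^ 2)) {n : ℕ}
    (hnT : 3 / 10 * max 1 (a ^ 2 * (σ₁ : ℝ) ^ 2) ≤ n) :
    1 + ENNReal.ofReal (27 / 130 * a ^ 2 * (σ₂ : ℝ) ^ 2) ≤
      secondMoment (noiseLaw σ₀ σ₁ σ₂) (fun ω => state a f₁ f₂ ω (n + 1)) +
      ENNReal.ofReal (100 / 13 * (σ₂ : ℝ) ^ 2 / max 1 (a ^ 2 * (σ₁ : ℝ) ^ 2)) *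
        secondMoment (noiseLaw σ₀ σ₁ σ₂) (fun ω => input₁ a f₁ f₂ ω n) := by
  obtain ⟨e, φ, P, h, hP⟩ := exists_isInnovation (σ₀ := σ₀) ha hσ f₁ f₂ n
  rw [min_eq_right hnT] at hP
  have hφ := h.measurable_rest
  have hi₁ := measurable_inputOfHistory₁ f₁ n
  have hi₂ := measurable_inputOfHistory₂ f₂ n
  have ht := le_lintegral_sq_of_small_first_control a h.isGaussianNoise
    (measurable_history a f₁ f₂ n) h.indepFun_stageNoise
    (g₁ := fun p => inputOfHistory₁ f₁ n (p.1, p.2 + φ p.1))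
    (g₂ := fun p => a * φ p.1 + inputOfHistory₂ f₂ n (p.1, p.2 + φ p.1))
    (by fun_prop) (by fun_prop) (m := max 1 (a ^ 2 * (σ₁ : ℝ) ^ 2)) (by positivity) hP
    (sq_nonneg _) hweak
  have e₁ : ∀ ω, inputOfHistory₁ f₁ n (history a f₁ f₂ n ω,
      stageNoise n e 0 ω + stageNoise n e 1 ω + φ (history a f₁ f₂ n ω)) =
      input₁ a f₁ f₂ ω n := fun ω => by
    rw [input₁_eq, h.state_eq, add_right_comm]
    rfl
  have e₂ : ∀ ω, a * stageNoise n e 0 ω + input₁ a f₁ f₂ ω n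
      + (a * φ (history a f₁ f₂ n ω) + inputOfHistory₂ f₂ n (history a f₁ f₂ n ω,
          stageNoise n e 0 ω + stageNoise n e 2 ω + φ (history a f₁ f₂ n ω))) =
      a * state a f₁ f₂ ω n + input₁ a f₁ f₂ ω n + input₂ a f₁ f₂ ω n := fun ω => by
    have : input₂ a f₁ f₂ ω n = inputOfHistory₂ f₂ n (history a f₁ f₂ n ω,
        stageNoise n e 0 ω + stageNoise n e 2 ω + φ (history a f₁ f₂ n ω)) := by
      rw [input₂_eq, h.state_eq, add_right_comm]
      rfl
    rw [← this, h.state_eq, show stageNoise n e 0 = e from rfl]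
    ring
  simp only [e₁, e₂] at ht
  refine (add_le_add_right ht 1).trans ?_
  rw [← add_assoc]
  exact add_le_add_left (one_add_secondMoment_le a f₁ f₂ ha hσ n) _

/-- Controls of small power cannot prevent the growth of the state. -/
theorem mul_secondMoment_state_le (ha : 25 / 4 ≤ a ^ 2) (hσ : σ₁ ≤ σ₂) (n : ℕ) :
    ENNReal.ofReal (a ^ 2 / 2) *
        secondMoment (noiseLaw σ₀ σ₁ σ₂) (fun ω => state a f₁ f₂ ω n) ≤
      secondMoment (noiseLaw σ₀ σ₁ σ₂) (fun ω => state a f₁ f₂ ω (n + 1)) +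
      2 * (secondMoment (noiseLaw σ₀ σ₁ σ₂) (fun ω => input₁ a f₁ f₂ ω n) +
        secondMoment (noiseLaw σ₀ σ₁ σ₂) (fun ω => input₂ a f₁ f₂ ω n)) := by
  have hx := measurable_state a f₁ f₂ n
  have hu₁ := measurable_input₁ a f₁ f₂ n
  have hu₂ := measurable_input₂ a f₁ f₂ n
  refine (mul_lintegral_sq_le_add a (x := fun ω => state a f₁ f₂ ω n)
    (X := fun ω => a * state a f₁ f₂ ω n + input₁ a f₁ f₂ ω n + input₂ a f₁ f₂ ω n)
    (u₁ := fun ω => input₁ a f₁ f₂ ω n) (u₂ := fun ω => input₂ a f₁ f₂ ω n)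
    (by fun_prop) hu₁ fun ω => rfl).trans ?_
  exact add_le_add_left (le_add_self.trans (one_add_secondMoment_le a f₁ f₂ ha hσ n)) _

end StateBounds

/-! ### Long-term averages -/

section Averages

theorem le_limsup_div_of_frequently {S : ℕ → ℝ≥0∞} {B R : ℝ≥0∞} (hR : R ≠ ∞)
    (h : ∃ᶠ N : ℕ in atTop, N * B ≤ S N + R) : B ≤ limsup (fun N : ℕ => S N / N) atTop := by
  refine le_of_forall_lt_imp_le_of_dense fun b hb => ?_
  refine le_limsup_of_frequently_le' ?_
  obtain ⟨N₀, hN₀⟩ := ENNReal.exists_nat_mul_gt (tsub_pos_of_lt hb).ne' hR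
  refine (h.and_eventually ((eventually_ge_atTop N₀).and (eventually_gt_atTop 0))).mono ?_
  rintro N ⟨hN, hN₀', hN1⟩
  rw [ENNReal.le_div_iff_mul_le (Or.inl (by simpa using hN1.ne')) (Or.inl (by simp)), mul_comm]
  refine (ENNReal.add_le_add_iff_right hR).1 (le_trans ?_ hN)
  calc N * b + R ≤ N * b + N * (B - b) := by
        gcongr
        exact hN₀.le.trans (by gcongr)
    _ = N * B := by rw [← mul_add, add_tsub_cancel_of_le hb.le]

theorem le_sum_range_add {Y : ℕ → ℝ≥0∞} {C : ℝ≥0∞} {n₀ : ℕ} (h : ∀ n, n₀ ≤ n → C ≤ Y n) (N : ℕ) :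
    N * C ≤ ∑ n ∈ Finset.range N, Y n + n₀ * C := by
  induction N with
  | zero => simp
  | succ N ih =>
    rcases le_or_gt n₀ N with hN | hN
    · rw [Finset.sum_range_succ, Nat.cast_succ, add_mul, one_mul, add_right_comm]
      exact add_le_add ih (h N hN)
    · refine le_trans ?_ le_add_self
      gcongr
      exact_mod_cast hN

/-- A sequence which grows at least linearly and eventually doubles in each step grows faster than
linearly. -/
theorem limsup_div_eq_top {S : ℕ → ℝ≥0∞} {c : ℝ≥0∞} (hc : c ≠ 0)
    (hS : ∀ᶠ N : ℕ in atTop, N * c ≤ S N) (h2 : ∀ᶠ N : ℕ in atTop, 2 * S N ≤ S (N + 1)) :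
    limsup (fun N : ℕ => S N / N) atTop = ∞ := by
  -- Two steps quadruple `S`, while `N + 2 ≤ 2 * N`: the slope of the linear bound can be doubled.
  have hpow : ∀ k : ℕ, ∀ᶠ N : ℕ in atTop, N * (2 ^ k * c) ≤ S N := by
    intro k
    induction k with
    | zero => simpa using hS
    | succ k ih =>
      have h22 : ∀ᶠ N : ℕ in atTop, (N + 2 : ℕ) * (2 ^ (k + 1) * c) ≤ S (N + 2) := by
        filter_upwards [ih, h2, (tendsto_add_atTop_nat 1).eventually h2, eventually_ge_atTop 2]
          with N h1 h3 h4 h5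
        have h6 : ((N + 2 : ℕ) : ℝ≥0∞) ≤ 2 * N := by
          have : N + 2 ≤ 2 * N := by omega
          exact_mod_cast this
        calc ((N + 2 : ℕ) : ℝ≥0∞) * (2 ^ (k + 1) * c) ≤ 2 * N * (2 ^ (k + 1) * c) := by gcongr
          _ = 2 * (2 * (N * (2 ^ k * c))) := by rw [pow_succ]; ring
          _ ≤ 2 * (2 * S N) := by gcongr
          _ ≤ 2 * S (N + 1) := by gcongr
          _ ≤ S (N + 2) := h4
      obtain ⟨M, hM⟩ := eventually_atTop.1 h22
      refine eventually_atTop.2 ⟨M + 2, fun N hN => ?_⟩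
      obtain ⟨N', rfl⟩ := Nat.exists_eq_add_of_le' (show 2 ≤ N by omega)
      exact hM N' (by omega)
  by_contra hL
  obtain ⟨k, hk⟩ := ENNReal.exists_nat_mul_gt hc hL
  have h1 : 2 ^ k * c ≤ limsup (fun N : ℕ => S N / N) atTop :=
    le_limsup_div_of_frequently (R := 0) (by simp) (by simpa using (hpow k).frequently)
  have h3 : (k : ℝ≥0∞) * c ≤ 2 ^ k * c := by
    gcongr
    exact_mod_cast Nat.lt_two_pow_self.le
  exact absurd (hk.trans_le (h3.trans h1)) (lt_irrefl _)

/-- If both powers are below their thresholds, the state doubles its cumulative second moment. -/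
theorem eventually_two_mul_le {X U V : ℕ → ℝ≥0∞} {θ c₁ c₂ B R : ℝ≥0∞} (hθ : θ ≠ ∞) (hR : R ≠ ∞)
    (hX : Monotone X) (hstep : ∀ N, (2 + θ) * X N ≤ X (N + 1) + 2 * (U N + V N))
    (hc : 2 * (c₁ + c₂) < θ * B) :
    ∀ᶠ N : ℕ in atTop, N * B ≤ X N + R → U N ≤ N * c₁ → V N ≤ N * c₂ →
      2 * X N ≤ X (N + 1) := by
  obtain ⟨N₀, hN₀⟩ := ENNReal.exists_nat_mul_gt (tsub_pos_of_lt hc).ne' (ENNReal.mul_ne_top hθ hR)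
  filter_upwards [eventually_ge_atTop N₀] with N hN hB hU hV
  by_cases hfin : X N = ∞
  · have : X (N + 1) = ∞ := top_le_iff.1 (hfin ▸ hX N.le_succ)
    simp [this]
  have hθX : θ * X N ≠ ∞ := ENNReal.mul_ne_top hθ hfin
  have h1 : N * (2 * (c₁ + c₂)) ≤ θ * X N := by
    refine (ENNReal.add_le_add_iff_right (ENNReal.mul_ne_top hθ hR)).1 ?_
    calc N * (2 * (c₁ + c₂)) + θ * R
        ≤ N * (2 * (c₁ + c₂)) + N * (θ * B - 2 * (c₁ + c₂)) := by
          exact add_le_add_right (hN₀.le.trans (by gcongr)) _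
      _ = θ * (N * B) := by rw [← mul_add, add_tsub_cancel_of_le hc.le]; ring
      _ ≤ θ * (X N + R) := by gcongr
      _ = θ * X N + θ * R := mul_add _ _ _
  refine (ENNReal.add_le_add_iff_right hθX).1 ?_
  calc 2 * X N + θ * X N = (2 + θ) * X N := (add_mul _ _ _).symm
    _ ≤ X (N + 1) + 2 * (U N + V N) := hstep N
    _ ≤ X (N + 1) + 2 * (N * c₁ + N * c₂) := by gcongr
    _ = X (N + 1) + N * (2 * (c₁ + c₂)) := by ring
    _ ≤ X (N + 1) + θ * X N := by gcongr

/-- The cost is bounded below according to which of the two controllers spends, infinitely often,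
an average power above its threshold. Here `X`, `U`, `V` are cumulative second moments. -/
theorem min_le_limsup_cost {X U V : ℕ → ℝ≥0∞} {q r₁ r₂ c₁ c₂ B C R : ℝ≥0∞} (hq : q ≠ 0)
    (hq' : q ≠ ∞) (hR : R ≠ ∞) (hB0 : B ≠ 0)
    (hC : ∀ N : ℕ, N * C ≤ X N + R)
    (hB : ∀ N : ℕ, U N ≤ N * c₁ → N * B ≤ X N + R)
    (hA : ∀ᶠ N : ℕ in atTop, U N ≤ N * c₁ → V N ≤ N * c₂ → 2 * X N ≤ X (N + 1)) :
    min (q * B + r₂ * c₂) (q * C + r₁ * c₁) ≤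
      limsup (fun N : ℕ => (q * X N + r₁ * U N + r₂ * V N) / N) atTop := by
  by_cases hU : ∃ᶠ N : ℕ in atTop, N * c₁ ≤ U N
  · refine (min_le_right _ _).trans (le_limsup_div_of_frequently (ENNReal.mul_ne_top hq' hR) ?_)
    refine hU.mono fun N hN => ?_
    calc N * (q * C + r₁ * c₁) = q * (N * C) + r₁ * (N * c₁) := by ring
      _ ≤ q * (X N + R) + r₁ * U N + r₂ * V N :=
          (add_le_add (mul_le_mul_right (hC N) q) (mul_le_mul_right hN r₁)).trans le_self_add
      _ = _ := by ring
  have hU' : ∀ᶠ N : ℕ in atTop, U N ≤ N * c₁ :=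
    (not_frequently.1 hU).mono fun N hN => (not_le.1 hN).le
  by_cases hV : ∃ᶠ N : ℕ in atTop, N * c₂ ≤ V N
  · refine (min_le_left _ _).trans (le_limsup_div_of_frequently (ENNReal.mul_ne_top hq' hR) ?_)
    refine (hV.and_eventually hU').mono fun N hN => ?_
    calc N * (q * B + r₂ * c₂) = q * (N * B) + r₂ * (N * c₂) := by ring
      _ ≤ q * (X N + R) + r₁ * U N + r₂ * V N :=
          add_le_add ((mul_le_mul_right (hB N hN.2) q).trans le_self_add)
            (mul_le_mul_right hN.1 r₂)
      _ = _ := by ring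
  have hV' : ∀ᶠ N : ℕ in atTop, V N ≤ N * c₂ :=
    (not_frequently.1 hV).mono fun N hN => (not_le.1 hN).le
  have htop : limsup (fun N : ℕ => q * X N / N) atTop = ∞ := by
    have hB2 : B / 2 ≠ 0 := by simpa using hB0
    refine limsup_div_eq_top (c := q * (B / 2)) (mul_ne_zero hq hB2) ?_ ?_
    · obtain ⟨N₀, hN₀⟩ := ENNReal.exists_nat_mul_gt hB2 hR
      filter_upwards [hU', eventually_ge_atTop N₀] with N hN hN'
      have hX : N * (B / 2) ≤ X N := by
        refine (ENNReal.add_le_add_iff_right hR).1 ?_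
        calc N * (B / 2) + R ≤ N * (B / 2) + N * (B / 2) := by
              gcongr
              exact hN₀.le.trans (by gcongr)
          _ = N * B := by rw [← mul_add, ENNReal.add_halves]
          _ ≤ X N + R := hB N hN
      calc N * (q * (B / 2)) = q * (N * (B / 2)) := by ring
        _ ≤ q * X N := by gcongr
    · filter_upwards [hU', hV', hA] with N h1 h2 h3
      calc 2 * (q * X N) = q * (2 * X N) := by ring
        _ ≤ q * X (N + 1) := mul_le_mul_right (h3 h1 h2) q
  refine le_top.trans (htop.symm.le.trans (limsup_le_limsup (Eventually.of_forall fun N => ?_)))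
  dsimp only
  gcongr
  rw [add_assoc]
  exact le_self_add

end Averages

/-! ### The lower bound of the cost -/

section Cost

/-- The threshold of the average power of a controller with observation noise `σ`. Its constant
exceeds `1 / 400`, so that the lower bound may be infinite on the half-open range of powers below the
threshold only; this makes it lower semicontinuous, and its minimum is attained. -/
noncomputable def powerThreshold (a : ℝ) (σ : ℝ≥0) : ℝ≥0 :=
  (a ^ 2 / 300 * max 1 (a ^ 2 * (σ : ℝ) ^ 2)).toNNReal

/-- Lower bound of the average second moment of the state for strategies of any power. -/
noncomputable def stateBound (a : ℝ) (σ₁ : ℝ≥0) : ℝ≥0∞ :=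
  ENNReal.ofReal (3 / 10 * max 1 (a ^ 2 * (σ₁ : ℝ) ^ 2))

/-- Lower bound of the average second moment of the state when the power of the first controller
is below its threshold. -/
noncomputable def weakFirstBound (a : ℝ) (σ₁ σ₂ : ℝ≥0) : ℝ≥0∞ :=
  max (ENNReal.ofReal (1 + 71 / 390 * a ^ 2 * (σ₂ : ℝ) ^ 2)) (stateBound a σ₁)

/-- The step function bounding the average second moment of the state in terms of the powers. -/
noncomputable def distortionBound (a : ℝ) (σ₁ σ₂ P₁ P₂ : ℝ≥0) : ℝ≥0∞ :=
  if P₁ < powerThreshold a σ₁ then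
    if P₂ < powerThreshold a σ₂ then ∞ else weakFirstBound a σ₁ σ₂
  else stateBound a σ₁

theorem coe_powerThreshold (a : ℝ) (σ : ℝ≥0) :
    (powerThreshold a σ : ℝ) = a ^ 2 / 300 * max 1 (a ^ 2 * (σ : ℝ) ^ 2) :=
  Real.coe_toNNReal _ (by positivity)

theorem lt_powerThreshold {a : ℝ} (ha : 25 / 4 ≤ a ^ 2) {σ P : ℝ≥0}
    (hP : (P : ℝ) ≤ 1 / 400 * a ^ 2 * max 1 (a ^ 2 * (σ : ℝ) ^ 2)) : P < powerThreshold a σ := by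
  rw [← NNReal.coe_lt_coe, coe_powerThreshold]
  have : 0 < a ^ 2 * max 1 (a ^ 2 * (σ : ℝ) ^ 2) := by positivity
  nlinarith

theorem stateBound_le_distortionBound (a : ℝ) (σ₁ σ₂ P₁ P₂ : ℝ≥0) :
    stateBound a σ₁ ≤ distortionBound a σ₁ σ₂ P₁ P₂ := by
  unfold distortionBound
  split_ifs
  · exact le_top
  · exact le_max_right _ _
  · exact le_rfl

variable {σ₀ σ₁ σ₂ : ℝ≥0} {a : ℝ}

theorem min_le_averageCost (ha : 25 / 4 ≤ a ^ 2) (hσ : σ₁ ≤ σ₂)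
    (hweak : (σ₂ : ℝ) ^ 2 ≤ max 1 (a ^ 2 * (σ₁ : ℝ) ^ 2)) {q : ℝ≥0} (hq : q ≠ 0) (r₁ r₂ : ℝ≥0)
    (f₁ f₂ : CausalStrategy) :
    min (q * weakFirstBound a σ₁ σ₂ + r₂ * powerThreshold a σ₂)
        (q * stateBound a σ₁ + r₁ * powerThreshold a σ₁) ≤
      averageCost a σ₀ σ₁ σ₂ q r₁ r₂ f₁ f₂ := by
  set x : ℕ → ℝ≥0∞ := fun n => secondMoment (noiseLaw σ₀ σ₁ σ₂) (fun ω => state a f₁ f₂ ω n)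
    with hx
  set u : ℕ → ℝ≥0∞ := fun n => secondMoment (noiseLaw σ₀ σ₁ σ₂) (fun ω => input₁ a f₁ f₂ ω n)
    with hu
  set v : ℕ → ℝ≥0∞ := fun n => secondMoment (noiseLaw σ₀ σ₁ σ₂) (fun ω => input₂ a f₁ f₂ ω n)
    with hv
  set m₁ : ℝ := max 1 (a ^ 2 * (σ₁ : ℝ) ^ 2) with hm₁
  set m₂ : ℝ := max 1 (a ^ 2 * (σ₂ : ℝ) ^ 2) with hm₂
  have hm₁0 : 0 < m₁ := by positivity
  have hm₁₂ : m₁ ≤ m₂ :=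
    max_le_max le_rfl (by gcongr)
  set s : ℝ := a ^ 2 * (σ₂ : ℝ) ^ 2 with hs
  have hs0 : 0 ≤ s := by positivity
  set X : ℕ → ℝ≥0∞ := fun N => ∑ n ∈ Finset.range N, x n with hX
  set U : ℕ → ℝ≥0∞ := fun N => ∑ n ∈ Finset.range N, u n with hU
  set V : ℕ → ℝ≥0∞ := fun N => ∑ n ∈ Finset.range N, v n with hV
  have hXsucc : ∀ N, ∑ n ∈ Finset.range N, x (n + 1) ≤ X (N + 1) := fun N => by
    simp only [hX, Finset.sum_range_succ']
    exact le_self_add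
  set n₀ : ℕ := ⌈3 / 10 * m₁⌉₊ with hn₀
  have hn₀' : ∀ n, n₀ ≤ n → 3 / 10 * m₁ ≤ n := fun n hn => Nat.ceil_le.1 hn
  set K : ℝ≥0∞ := ENNReal.ofReal (100 / 13 * (σ₂ : ℝ) ^ 2 / m₁) with hK
  set L : ℝ≥0∞ := 1 + ENNReal.ofReal (27 / 130 * a ^ 2 * (σ₂ : ℝ) ^ 2) with hL
  set B : ℝ≥0∞ := ENNReal.ofReal (1 + 71 / 390 * a ^ 2 * (σ₂ : ℝ) ^ 2) with hB
  have hc₁ : (powerThreshold a σ₁ : ℝ≥0∞) = ENNReal.ofReal (a ^ 2 / 300 * m₁) := rfl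
  have hc₂ : (powerThreshold a σ₂ : ℝ≥0∞) = ENNReal.ofReal (a ^ 2 / 300 * m₂) := rfl
  -- At the threshold the first control lowers the bound by `71 / 390 - 27 / 130 = -1 / 39`.
  have hLB : L = B + K * powerThreshold a σ₁ := by
    rw [hL, hB, hK, hc₁, ← ENNReal.ofReal_one, ← ENNReal.ofReal_mul (by positivity),
      ← ENNReal.ofReal_add (by positivity) (by positivity),
      ← ENNReal.ofReal_add (by positivity) (by positivity)]
    congr 1
    field_simp
    ring
  have hLtop : L ≠ ∞ := by simp [hL]
  have hKtop : K ≠ ∞ := ENNReal.ofReal_ne_top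
  have hCtop : stateBound a σ₁ ≠ ∞ := ENNReal.ofReal_ne_top
  have boundC : ∀ N : ℕ, N * stateBound a σ₁ ≤ X N + n₀ * stateBound a σ₁ :=
    le_sum_range_add fun n hn => le_secondMoment_state a f₁ f₂ ha hσ (hn₀' n hn)
  -- The inputs at time `n` are paired with the state at time `n + 1`, so that one more term than in
  -- `boundC` has to be absorbed in the constant.
  have boundL : ∀ N : ℕ, N * L ≤ X N + K * U N + (n₀ + 1) * L := by
    intro N
    cases N with
    | zero => simp
    | succ N =>
      have h := le_sum_range_add (Y := fun n => x (n + 1) + K * u n) (C := L) (n₀ := n₀)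
        (fun n hn => le_secondMoment_state_succ_add a f₁ f₂ ha hσ hweak (hn₀' n hn)) N
      rw [Finset.sum_add_distrib, ← Finset.mul_sum] at h
      have hUm : ∑ n ∈ Finset.range N, u n ≤ U (N + 1) := by
        simp only [hU, Finset.sum_range_succ]
        exact le_self_add
      calc ((N + 1 : ℕ) : ℝ≥0∞) * L = N * L + L := by push_cast; ring
        _ ≤ X (N + 1) + K * U (N + 1) + n₀ * L + L := by
          gcongr
          exact h.trans (by gcongr; exact hXsucc N)
        _ = _ := by ring
  set R : ℝ≥0∞ := n₀ * stateBound a σ₁ + (n₀ + 1) * L with hR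
  have hRtop : R ≠ ∞ := ENNReal.add_ne_top.2 ⟨ENNReal.mul_ne_top (by simp) hCtop,
    ENNReal.mul_ne_top (by simp) hLtop⟩
  have boundB : ∀ N : ℕ, U N ≤ N * powerThreshold a σ₁ →
      N * weakFirstBound a σ₁ σ₂ ≤ X N + R := by
    intro N hN
    unfold weakFirstBound
    rcases max_choice B (stateBound a σ₁) with h | h
    · rw [h]
      have htop : K * (N * powerThreshold a σ₁) ≠ ∞ :=
        ENNReal.mul_ne_top hKtop (ENNReal.mul_ne_top (by simp) (by simp))
      refine (ENNReal.add_le_add_iff_right htop).1 ?_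
      calc N * B + K * (N * powerThreshold a σ₁) = N * L := by rw [hLB]; ring
        _ ≤ X N + K * U N + (n₀ + 1) * L := boundL N
        _ ≤ X N + K * (N * powerThreshold a σ₁) + R := by
          gcongr
          exact le_add_self
        _ = _ := by ring
    · rw [h]
      exact (boundC N).trans (by gcongr; exact le_self_add)
  have hXmono : Monotone X := fun M N hMN =>
    Finset.sum_le_sum_of_subset (Finset.range_mono hMN)
  have hstep : ∀ N, (2 + ENNReal.ofReal (a ^ 2 / 2 - 2)) * X N ≤ X (N + 1) + 2 * (U N + V N) := by
    intro N
    have h2 : 2 + ENNReal.ofReal (a ^ 2 / 2 - 2) = ENNReal.ofReal (a ^ 2 / 2) := by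
      rw [← ENNReal.ofReal_ofNat 2, ← ENNReal.ofReal_add (by norm_num) (by linarith)]
      congr 1
      ring
    rw [h2, Finset.mul_sum]
    refine (Finset.sum_le_sum fun n _ => mul_secondMoment_state_le a f₁ f₂ ha hσ n).trans ?_
    rw [Finset.sum_add_distrib, ← Finset.mul_sum, Finset.sum_add_distrib]
    gcongr
    exact hXsucc N
  have hgap : 2 * ((powerThreshold a σ₁ : ℝ≥0∞) + powerThreshold a σ₂) <
      ENNReal.ofReal (a ^ 2 / 2 - 2) * weakFirstBound a σ₁ σ₂ := by
    refine lt_of_lt_of_le ?_ (mul_le_mul_right (le_max_left _ _) _)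
    rw [hc₁, hc₂, ← ENNReal.ofReal_add (by positivity) (by positivity),
      ← ENNReal.ofReal_ofNat 2, ← ENNReal.ofReal_mul (by norm_num),
      ← ENNReal.ofReal_mul (by linarith)]
    have hm₂s : m₂ ≤ 1 + s := max_le (by linarith) (by linarith)
    refine (ENNReal.ofReal_lt_ofReal_iff_of_nonneg (by positivity)).2 ?_
    have h1 : 2 * (a ^ 2 / 300 * m₁ + a ^ 2 / 300 * m₂) ≤ a ^ 2 / 75 * (1 + s) := by
      nlinarith [mul_le_mul_of_nonneg_left hm₁₂ (sq_nonneg a),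
        mul_le_mul_of_nonneg_left hm₂s (sq_nonneg a)]
    have h2 : a ^ 2 / 75 * (1 + s) < 9 / 50 * a ^ 2 * (71 / 390 * (1 + s)) := by
      nlinarith [mul_nonneg (sq_nonneg a) hs0]
    have h3 : 71 / 390 * (1 + s) ≤ 1 + 71 / 390 * a ^ 2 * (σ₂ : ℝ) ^ 2 := by
      rw [hs]; linarith
    refine h1.trans_lt (h2.trans_le ?_)
    exact mul_le_mul (by linarith) h3 (by positivity) (by linarith)
  have hA := eventually_two_mul_le (U := U) (V := V) ENNReal.ofReal_ne_top hRtop hXmono hstep hgap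
  have key := min_le_limsup_cost (X := X) (U := U) (V := V) (q := q) (r₁ := r₁) (r₂ := r₂)
    (by simpa using hq) (by simp) hRtop
    (B := weakFirstBound a σ₁ σ₂) (C := stateBound a σ₁)
    (fun h => by rw [h, mul_zero] at hgap; exact not_lt_zero hgap)
    (fun N => (boundC N).trans (by gcongr; exact le_self_add)) boundB
    (hA.mono fun N h h1 h2 => h (boundB N h1) h1 h2)
  refine key.trans (le_of_eq ?_)
  unfold averageCost
  simp only [Finset.sum_add_distrib, ← Finset.mul_sum]
  rfl

end Cost

theorem corollary1 (a : ℝ) (σ₁ σ₂ : ℝ≥0) (ha : (2.5 : ℝ) ≤ |a|) (hσ : σ₁ ≤ σ₂)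
    (hweak : (σ₂ : ℝ) ^ 2 ≤ max 1 (a ^ 2 * (σ₁ : ℝ) ^ 2)) :
    ∃ D_L : ℝ≥0 → ℝ≥0 → ℝ≥0∞,
      (∀ P₁ P₂ : ℝ≥0,
        (P₁ : ℝ) ≤ 1 / 400 * a ^ 2 * max 1 (a ^ 2 * (σ₁ : ℝ) ^ 2) →
        (P₂ : ℝ) ≤ 1 / 400 * a ^ 2 * max 1 (a ^ 2 * (σ₂ : ℝ) ^ 2) →
        D_L P₁ P₂ = ∞) ∧
      (∀ P₁ P₂ : ℝ≥0,
        (P₁ : ℝ) ≤ 1 / 400 * a ^ 2 * max 1 (a ^ 2 * (σ₁ : ℝ) ^ 2) →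
        ENNReal.ofReal (0.176 * a ^ 2 * (σ₂ : ℝ) ^ 2 + 1) ≤ D_L P₁ P₂) ∧
      (∀ P₁ P₂ : ℝ≥0,
        ENNReal.ofReal (0.295 * max 1 (a ^ 2 * (σ₁ : ℝ) ^ 2)) ≤ D_L P₁ P₂) ∧
      (∀ σ₀ q r₁ r₂ : ℝ≥0, ∃ m : ℝ≥0∞,
        IsLeast
          (Set.range fun P : ℝ≥0 × ℝ≥0 =>
            (q : ℝ≥0∞) * D_L P.1 P.2 + (r₁ : ℝ≥0∞) * (P.1 : ℝ≥0∞) + (r₂ : ℝ≥0∞) * (P.2 : ℝ≥0∞))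
          m ∧
        m ≤ optimalCost a σ₀ σ₁ σ₂ q r₁ r₂) := by
  have ha' : 25 / 4 ≤ a ^ 2 := by
    rw [← sq_abs]
    nlinarith
  have hpos : ∀ σ : ℝ≥0, 0 < powerThreshold a σ := fun σ => lt_powerThreshold ha' (by
    rw [NNReal.coe_zero]
    positivity)
  refine ⟨distortionBound a σ₁ σ₂, fun P₁ P₂ h₁ h₂ => ?_, fun P₁ P₂ h₁ => ?_, fun P₁ P₂ => ?_,
    fun σ₀ q r₁ r₂ => ?_⟩
  · simp [distortionBound, lt_powerThreshold ha' h₁, lt_powerThreshold ha' h₂]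
  · rw [distortionBound, if_pos (lt_powerThreshold ha' h₁)]
    split_ifs
    · exact le_top
    · refine (ENNReal.ofReal_le_ofReal ?_).trans (le_max_left _ _)
      have : 0 ≤ a ^ 2 * (σ₂ : ℝ) ^ 2 := by positivity
      linarith
  · refine (ENNReal.ofReal_le_ofReal ?_).trans (stateBound_le_distortionBound a σ₁ σ₂ P₁ P₂)
    have : 0 ≤ max 1 (a ^ 2 * (σ₁ : ℝ) ^ 2) := by positivity
    linarith
  · rcases eq_or_ne q 0 with rfl | hq
    · exact ⟨0, ⟨⟨(0, 0), by simp⟩, fun _ _ => zero_le⟩, zero_le⟩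
    refine ⟨min (q * weakFirstBound a σ₁ σ₂ + r₂ * powerThreshold a σ₂)
      (q * stateBound a σ₁ + r₁ * powerThreshold a σ₁), ⟨?_, ?_⟩,
      le_iInf₂ fun f₁ f₂ => min_le_averageCost ha' hσ hweak hq r₁ r₂ f₁ f₂⟩
    · rcases min_choice (q * weakFirstBound a σ₁ σ₂ + r₂ * powerThreshold a σ₂ : ℝ≥0∞)
        (q * stateBound a σ₁ + r₁ * powerThreshold a σ₁) with h | h
      · rw [h]
        exact ⟨(0, powerThreshold a σ₂), by simp [distortionBound, hpos]⟩
      · rw [h]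
        exact ⟨(powerThreshold a σ₁, 0), by simp [distortionBound]⟩
    · rintro _ ⟨⟨P₁, P₂⟩, rfl⟩
      dsimp only
      by_cases h₁ : P₁ < powerThreshold a σ₁
      · by_cases h₂ : P₂ < powerThreshold a σ₂
        · have : (q : ℝ≥0∞) * ∞ = ∞ := ENNReal.mul_top (by simpa using hq)
          simp [distortionBound, h₁, h₂, this]
        · refine (min_le_left _ _).trans ?_
          rw [distortionBound, if_pos h₁, if_neg h₂]
          exact add_le_add le_self_add (mul_le_mul_right (by simpa using h₂) _)
      · refine (min_le_right _ _).trans ?_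
        rw [distortionBound, if_neg h₁]
        exact le_add_right (add_le_add le_rfl (mul_le_mul_right (by simpa using h₁) _))
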